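/- Let $\mathcal Q_0,\tilde{\mathcal Q}_1,\mathcal S,\mathcal X$ be finite alphabets, $\mathcal S\neq\emptyset$, let $p(q_0,\tilde q_1)$ be a p.m.f. on $\mathcal Q_0\times\tilde{\mathcal Q}_1$ and let $p(x\mid s,q_0,\tilde q_1)$ be a conditional p.m.f. Consider the following context-dependent channel. The context pairs $(Q_{0,i},\tilde Q_{1,i})$, $i=1,\dots,n$, are i.i.d. with p.m.f. $p(q_0,\tilde q_1)$; the semantic $W$ is uniform on $M$ values and independent of the contexts. The sender knows $Q_1^n=(Q_0^n,\tilde Q_1^n)$ non-causally and encodes $S^n=f_n(W,Q_0^n,\tilde Q_1^n)$. Given $(W,S^n,Q_0^n,\tilde Q_1^n)$, the message codeword $X^n$ has conditional p.m.f. $\prod_{i=1}^n p(x_i\mid s_i,q_{0,i},\tilde q_{1,i})$. The receiver observes $X^n$ without noise, knows only the context $Q_2^n=Q_0^n$, and decodes $\hat W=g_n(X^n,Q_0^n)$. A rate $R\ge 0$ (in bits per symbol) is achievable if there are codes $(f_n,g_n)_n$ with $M=\lceil 2^{nR}\rceil$ and $P(\hat W\ne W)\to 0$ as $n\to\infty$.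 The capacity $C$ is the supremum of all achievable rates. Then the set of achievable rates is non-empty and bounded above, and $$C=\max_{p(u,s\mid q_0,\tilde q_1)}\bigl[I(U;X\mid Q_2)-I(U;\tilde Q_1\mid Q_0)\bigr],\qquad Q_2=Q_0,$$ where the maximum is over all finite alphabets $\mathcal U$ and all conditional p.m.f.s $p(u,s\mid q_0,\tilde q_1)$ on $\mathcal U\times\mathcal S$, is attained, and the mutual informations (in bits) are taken under the joint p.m.f. $p(q_0,\tilde q_1)\,p(u,s\mid q_0,\tilde q_1)\,p(x\mid s,q_0,\tilde q_1)$. -/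

import Mathlib

namespace SemanticChannel

open Filter Topology

/-- A block code with `M` semantics and block length `n`. The sender observes the whole context
sequence `(q₀ⁿ, q̃₁ⁿ)` before encoding (non-causally); the receiver observes the message codeword
`xⁿ` and only the part `q₀ⁿ` of the context. -/
structure Code (Q₀ Q₁ S X : Type*) (n M : ℕ) where
  /-- the semantic encoder `(w, q₀ⁿ, q̃₁ⁿ) ↦ sⁿ` -/
  enc : Fin M → (Fin n → Q₀ × Q₁) → (Fin n → S)
  /-- the semantic decoder `(xⁿ, q₀ⁿ) ↦ ŵ` -/
  dec : (Fin n → X) → (Fin n → Q₀) → Fin M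

section

variable {Q₀ Q₁ S X : Type*} [Fintype Q₀] [Fintype Q₁] [Fintype S] [Fintype X]

/-- Average probability of error `P(Ŵ ≠ W)`, where `W` is uniform on the `M` semantics, the context
pairs `(q₀, q̃₁)` are i.i.d. with p.m.f. `pQ` and independent of `W`, and the message codeword `xⁿ`
is generated from `sⁿ` and the sender's context letter by letter (memorylessly) with conditional
p.m.f. `p s q x = p(x | s, q₀, q̃₁)`. -/
noncomputable def errorProb (pQ : Q₀ × Q₁ → ℝ) (p : S → Q₀ × Q₁ → X → ℝ) {n M : ℕ}
    (c : Code Q₀ Q₁ S X n M) : ℝ :=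
  (1 / (M : ℝ)) * ∑ w : Fin M, ∑ q : Fin n → Q₀ × Q₁, (∏ i, pQ (q i)) *
    ∑ x : Fin n → X, (∏ i, p (c.enc w q i) (q i) (x i)) *
      (if c.dec x (fun i => (q i).1) = w then 0 else 1)

/-- `R ≥ 0` (in bits per channel use) is achievable if there is a sequence of codes with
`⌈2 ^ (n R)⌉` semantics at block length `n` whose probability of error tends to zero. -/
def Achievable (pQ : Q₀ × Q₁ → ℝ) (p : S → Q₀ × Q₁ → X → ℝ) (R : ℝ) : Prop :=
  0 ≤ R ∧ ∃ c : (n : ℕ) → Code Q₀ Q₁ S X n ⌈(2 : ℝ) ^ ((n : ℝ) * R)⌉₊,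
    Tendsto (fun n => errorProb pQ p (c n)) atTop (𝓝 0)

/-- The capacity: the supremum of the achievable rates. -/
noncomputable def capacity (pQ : Q₀ × Q₁ → ℝ) (p : S → Q₀ × Q₁ → X → ℝ) : ℝ :=
  sSup {R : ℝ | Achievable pQ p R}

/-- Conditional mutual information `I(A;B|C)` in bits of the joint p.m.f. `P a b c`. Summands with
`P a b c = 0` vanish; in the others all marginals are positive. -/
noncomputable def condMutualInfo {A B C : Type*} [Fintype A] [Fintype B] [Fintype C]
    (P : A → B → C → ℝ) : ℝ :=
  ∑ a, ∑ b, ∑ c, P a b c * Real.logb 2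
    ((P a b c * ∑ a', ∑ b', P a' b' c) / ((∑ b', P a b' c) * ∑ a', P a' b c))

/-- The joint p.m.f. `p(q₀, q̃₁) p(u, s | q₀, q̃₁) p(x | s, q₀, q̃₁)` of context, auxiliary variable
`U`, semantic codeword letter `S` and message codeword letter `X`, where `r q (u, s)` is
`p(u, s | q₀, q̃₁)`; thus `U → (S, Q₀, Q̃₁) → X` is a Markov chain. -/
def jointLaw {U : Type*} (pQ : Q₀ × Q₁ → ℝ) (p : S → Q₀ × Q₁ → X → ℝ)
    (r : Q₀ × Q₁ → U × S → ℝ) (u : U) (s : S) (q : Q₀ × Q₁) (x : X) : ℝ :=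
  pQ q * r q (u, s) * p s q x

/-- `I(U;X|Q₂) - I(U;Q̃₁|Q₀)` with `Q₂ = Q₀`, under the joint p.m.f. `jointLaw pQ p r`. -/
noncomputable def rateExpr {U : Type*} [Fintype U] (pQ : Q₀ × Q₁ → ℝ) (p : S → Q₀ × Q₁ → X → ℝ)
    (r : Q₀ × Q₁ → U × S → ℝ) : ℝ :=
  condMutualInfo (fun (u : U) (x : X) (q₀ : Q₀) => ∑ s, ∑ q₁, jointLaw pQ p r u s (q₀, q₁) x) -
  condMutualInfo (fun (u : U) (q₁ : Q₁) (q₀ : Q₀) => ∑ s, ∑ x, jointLaw pQ p r u s (q₀, q₁) x)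

end

end SemanticChannel

namespace SemanticChannel

open Filter Topology

/-! With `Q = (Q₀, Q̃₁)`, the terms `H(Q₀)` and `H(U,Q₀)` cancel between the two informations, so
the rate equals `H(U,Q) - H(U,X,Q₀) - H(Q) + H(X,Q₀)`. Writing `ν_u` for the mass function of
`(S,Q)` on the event `U = u`, and `G(ν) = H(Q) - H(X,Q₀)`, this is `∑ G(ν_u) - G(∑ ν_u)`
(`rateExpr_mul_log`).

Attainment (`exists_max_rateExpr`). `G` is continuous and positively homogeneous of degree one, so
the pairs `(∑ ν_u, ∑ G(ν_u))` are points of the convex hull of the graph of `G` over the simplex,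
with prescribed context marginal. By Carathéodory this hull is compact, so the rate has a maximum on
it; a convex decomposition of a maximiser is an auxiliary variable on a finite alphabet.

Converse (`log_le_of_rateExpr_le`). Interpolate from `(W, Qⁿ)` to `(W, Q₀ⁿ, Xⁿ)` by replacing one
private context letter at a time by the output letter. Each drop of entropy is controlled by the
rate expression with `auxView i` as `U`, since both hybrids around time `i` consist of `auxView i`
and one more letter. Telescoping does the work of Csiszár's sum identity. The first hybrid has
entropy `log M + ∑ H(Q_i)`, the last is bounded by Fano's inequality.

Achievability (`achievable_of_lt_rateExpr`). Given `q₀ⁿ`, draw a random codebook with one bin per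
semantic. The encoder picks a codeword in its bin with probability proportional to `p(q̃₁ⁿ|u)`, the
decoder one in the whole codebook proportionally to `p(xⁿ|u)`. A tangent-plane form of Jensen's
inequality bounds the success probability without typical sets (`sum_codebook_ratio_ge`), and
`exists_oneShot_code` removes the randomness. Over `n` letters the loss is at most two exponential
moments, which factorise; Chernoff's bound makes both decay once the bin rate exceeds `I(U;Q̃₁|Q₀)`
and the total rate stays below `I(U;X|Q₀)`. -/

/-! ### Convex hulls of compact sets -/

theorem sum_eq_sum_of_embedding {ι κ F : Type*} [Fintype ι] [Fintype κ] [AddCommMonoid F]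
    (e : ι ↪ κ) (g : κ → F) (h : ι → F) (h1 : ∀ i, g (e i) = h i)
    (h2 : ∀ j, (¬ ∃ i, e i = j) → g j = 0) : ∑ j, g j = ∑ i, h i := by
  symm
  refine Finset.sum_of_injOn e e.injective.injOn (by simp) ?_ fun i _ => (h1 i).symm
  intro j _ hj
  exact h2 j (by simpa using hj)

/-- The convex hull of a compact set in a finite-dimensional real space is compact. -/
theorem isCompact_convexHull_of_finiteDimensional {E : Type*} [NormedAddCommGroup E]
    [NormedSpace ℝ E] [FiniteDimensional ℝ E] {s : Set E} (hs : IsCompact s) :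
    IsCompact (convexHull ℝ s) := by
  classical
  rcases s.eq_empty_or_nonempty with rfl | ⟨x₀, hx₀⟩
  · simp
  -- Carathéodory's bound on the number of points: the hull becomes the image of one compact set of
  -- weights and `N`-tuples.
  set N := Module.finrank ℝ E + 1 with hN
  have hK : IsCompact (stdSimplex ℝ (Fin N) ×ˢ Set.pi Set.univ fun _ : Fin N => s) :=
    (isCompact_stdSimplex ℝ (Fin N)).prod (isCompact_univ_pi fun _ => hs)
  have hf : Continuous fun a : (Fin N → ℝ) × (Fin N → E) => ∑ i, a.1 i • a.2 i := by fun_prop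
  convert hK.image hf using 1
  ext x
  constructor
  · intro hx
    obtain ⟨ι, _, z, w, hz, hzi, hw, hw1, rfl⟩ := eq_pos_convex_span_of_mem_convexHull hx
    have hcard : Fintype.card ι ≤ N := by
      refine hzi.card_le_finrank_succ.trans ?_
      rw [hN]
      gcongr
      exact Submodule.finrank_le _
    obtain ⟨e⟩ : Nonempty (ι ↪ Fin N) :=
      Function.Embedding.nonempty_of_card_le (by simpa using hcard)
    -- Unused slots get weight zero and the dummy point `x₀`, which keeps the tuple inside `s`.
    refine ⟨(Function.extend e w 0, Function.extend e z fun _ => x₀), ⟨⟨?_, ?_⟩, ?_⟩, ?_⟩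
    · intro j
      by_cases hj : ∃ i, e i = j
      · obtain ⟨i, rfl⟩ := hj
        simpa [e.injective.extend_apply] using (hw i).le
      · simp [Function.extend_apply' _ _ _ hj]
    · rw [← hw1]
      exact sum_eq_sum_of_embedding e _ _ (fun i => e.injective.extend_apply _ _ _)
        fun j hj => by simp [Function.extend_apply' _ _ _ hj]
    · intro j _
      by_cases hj : ∃ i, e i = j
      · obtain ⟨i, rfl⟩ := hj
        simpa [e.injective.extend_apply] using hz (Set.mem_range_self i)
      · simpa [Function.extend_apply' _ _ _ hj] using hx₀
    · exact sum_eq_sum_of_embedding e _ _ (fun i => by simp [e.injective.extend_apply])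
        fun j hj => by simp [Function.extend_apply' _ _ _ hj]
  · rintro ⟨⟨w, z⟩, ⟨⟨hw0, hw1⟩, hz⟩, rfl⟩
    exact mem_convexHull_of_exists_fintype w z hw0 hw1 (fun i => hz i trivial) rfl

/-! ### Entropy of unnormalised mass functions -/

/-- Shannon entropy in nats of a finite mass function. -/
noncomputable def entropy {α : Type*} [Fintype α] (m : α → ℝ) : ℝ := ∑ a, Real.negMulLog (m a)

theorem continuous_entropy {α : Type*} [Fintype α] :
    Continuous (entropy : (α → ℝ) → ℝ) := by
  unfold entropy; fun_prop

theorem entropy_smul {α : Type*} [Fintype α] (c : ℝ) (m : α → ℝ) :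
    entropy (fun a => c * m a) = c * entropy m + Real.negMulLog c * ∑ a, m a := by
  simp only [entropy, Real.negMulLog_mul, Finset.sum_add_distrib, Finset.mul_sum]
  rw [add_comm]
  congr 1
  exact Finset.sum_congr rfl fun _ _ => mul_comm _ _

theorem entropy_prod {α β : Type*} [Fintype α] [Fintype β] (m : α × β → ℝ) :
    entropy m = ∑ a, entropy fun b => m (a, b) := by
  simp only [entropy, Fintype.sum_prod_type]

/-- The logarithm of the ratio splits into four wherever `P a b c > 0`, and each piece sums to a
marginal entropy. `P` need not be normalised. The joint entropy is kept as a sum over `a` because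
`a` will be the auxiliary letter. -/
theorem condMutualInfo_mul_log {A B C : Type*} [Fintype A] [Fintype B] [Fintype C]
    (P : A → B → C → ℝ) (hP : ∀ a b c, 0 ≤ P a b c) :
    condMutualInfo P * Real.log 2 =
      entropy (fun z : A × C => ∑ b, P z.1 b z.2) + entropy (fun z : B × C => ∑ a, P a z.1 z.2)
        - ∑ a, entropy (fun z : B × C => P a z.1 z.2) - entropy (fun c => ∑ a, ∑ b, P a b c) := by
  have h2 : Real.log 2 ≠ 0 := (Real.log_pos one_lt_two).ne'
  have key : ∀ a b c, P a b c * Real.logb 2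
      ((P a b c * ∑ a', ∑ b', P a' b' c) / ((∑ b', P a b' c) * ∑ a', P a' b c)) * Real.log 2 =
      P a b c * Real.log (P a b c) + P a b c * Real.log (∑ a', ∑ b', P a' b' c)
        - P a b c * Real.log (∑ b', P a b' c) - P a b c * Real.log (∑ a', P a' b c) := by
    intro a b c
    rcases (hP a b c).eq_or_lt with h | h
    · simp [← h]
    have h1 : 0 < ∑ b', P a b' c :=
      h.trans_le (Finset.single_le_sum (f := fun b' => P a b' c) (fun _ _ => hP _ _ _)
        (Finset.mem_univ b))
    have h3 : 0 < ∑ a', P a' b c :=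
      h.trans_le (Finset.single_le_sum (f := fun a' => P a' b c) (fun _ _ => hP _ _ _)
        (Finset.mem_univ a))
    have h4 : 0 < ∑ a', ∑ b', P a' b' c :=
      h1.trans_le (Finset.single_le_sum (f := fun a' => ∑ b', P a' b' c)
        (fun _ _ => Finset.sum_nonneg fun _ _ => hP _ _ _) (Finset.mem_univ a))
    rw [Real.logb, Real.log_div (by positivity) (by positivity), Real.log_mul h.ne' h4.ne',
      Real.log_mul h1.ne' h3.ne']
    field_simp
    ring
  have e1 : ∑ a, ∑ b, ∑ c, P a b c * Real.log (∑ a', ∑ b', P a' b' c) =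
      ∑ c, (∑ a, ∑ b, P a b c) * Real.log (∑ a', ∑ b', P a' b' c) := by
    simp only [Finset.sum_mul]
    rw [Finset.sum_comm (s := (Finset.univ : Finset C))]
    exact Finset.sum_congr rfl fun a _ => Finset.sum_comm
  have e2 : ∑ a, ∑ b, ∑ c, P a b c * Real.log (∑ b', P a b' c) =
      ∑ a, ∑ c, (∑ b, P a b c) * Real.log (∑ b', P a b' c) := by
    simp only [Finset.sum_mul]
    exact Finset.sum_congr rfl fun a _ => Finset.sum_comm
  have e3 : ∑ a, ∑ b, ∑ c, P a b c * Real.log (∑ a', P a' b c) =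
      ∑ b, ∑ c, (∑ a, P a b c) * Real.log (∑ a', P a' b c) := by
    simp only [Finset.sum_mul]
    rw [Finset.sum_comm]
    exact Finset.sum_congr rfl fun a _ => Finset.sum_comm
  have e0 : condMutualInfo P * Real.log 2 = ∑ a, ∑ b, ∑ c, P a b c * Real.log (P a b c)
      + ∑ a, ∑ b, ∑ c, P a b c * Real.log (∑ a', ∑ b', P a' b' c)
      - ∑ a, ∑ b, ∑ c, P a b c * Real.log (∑ b', P a b' c)
      - ∑ a, ∑ b, ∑ c, P a b c * Real.log (∑ a', P a' b c) := by
    simp only [← Finset.sum_add_distrib, ← Finset.sum_sub_distrib, ← key]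
    simp only [condMutualInfo, Finset.sum_mul _ _ (Real.log 2)]
  rw [e0, e1, e2, e3]
  simp only [entropy, Real.negMulLog, Fintype.sum_prod_type, neg_mul, Finset.sum_neg_distrib]
  ring

/-! ### The rate expression as an entropy gap, and its maximum -/

section

variable {Q₀ Q₁ S X U : Type*} [Fintype Q₀] [Fintype Q₁] [Fintype S] [Fintype X] [Fintype U]

/-- The marginal on `(x, q₀)` of the law on which `(s, q)` has mass function `ν`. -/
def outMarginal (p : S → Q₀ × Q₁ → X → ℝ) (ν : S × (Q₀ × Q₁) → ℝ) (z : X × Q₀) : ℝ :=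
  ∑ s, ∑ q₁, ν (s, (z.2, q₁)) * p s (z.2, q₁) z.1

/-- The context marginal of a mass function on `S × (Q₀ × Q₁)`. -/
def ctxMarginal (ν : S × (Q₀ × Q₁) → ℝ) (q : Q₀ × Q₁) : ℝ := ∑ s, ν (s, q)

/-- `H(Q₀, Q₁) - H(X, Q₀)` in nats, as a function of the mass function of `(S, Q₀, Q₁)`. -/
noncomputable def entropyGap (p : S → Q₀ × Q₁ → X → ℝ) (ν : S × (Q₀ × Q₁) → ℝ) : ℝ :=
  entropy (ctxMarginal ν) - entropy (outMarginal p ν)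

theorem sum_outMarginal {p : S → Q₀ × Q₁ → X → ℝ} (hp : ∀ s q, p s q ∈ stdSimplex ℝ X)
    (ν : S × (Q₀ × Q₁) → ℝ) : ∑ z, outMarginal p ν z = ∑ z, ν z := by
  have h : ∀ q₀, ∑ x, outMarginal p ν (x, q₀) = ∑ s, ∑ q₁, ν (s, (q₀, q₁)) := by
    intro q₀
    simp only [outMarginal]
    rw [Finset.sum_comm]
    refine Finset.sum_congr rfl fun s _ => ?_
    rw [Finset.sum_comm]
    refine Finset.sum_congr rfl fun q₁ _ => ?_
    rw [← Finset.mul_sum, (hp s (q₀, q₁)).2, mul_one]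
  rw [Fintype.sum_prod_type, Finset.sum_comm]
  simp only [h, Fintype.sum_prod_type]
  rw [Finset.sum_comm]

theorem sum_ctxMarginal (ν : S × (Q₀ × Q₁) → ℝ) : ∑ q, ctxMarginal ν q = ∑ z, ν z := by
  simp only [ctxMarginal, Fintype.sum_prod_type (f := ν)]
  rw [Finset.sum_comm]

/-- Scaling adds to each entropy the correction `negMulLog c` times the total mass; both marginals
have the same mass, so the corrections cancel. -/
theorem entropyGap_smul {p : S → Q₀ × Q₁ → X → ℝ} (hp : ∀ s q, p s q ∈ stdSimplex ℝ X)
    (c : ℝ) (ν : S × (Q₀ × Q₁) → ℝ) : entropyGap p (c • ν) = c * entropyGap p ν := by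
  have h1 : ctxMarginal (c • ν) = fun q => c * ctxMarginal ν q := by
    ext q; simp [ctxMarginal, Finset.mul_sum]
  have h2 : outMarginal p (c • ν) = fun q => c * outMarginal p ν q := by
    ext q; simp [outMarginal, Finset.mul_sum, mul_assoc]
  rw [entropyGap, h1, h2, entropy_smul, entropy_smul, sum_outMarginal hp, sum_ctxMarginal,
    entropyGap]
  ring

theorem continuous_entropyGap (p : S → Q₀ × Q₁ → X → ℝ) : Continuous (entropyGap p) := by
  refine (continuous_entropy.comp ?_).sub (continuous_entropy.comp ?_)
  · unfold ctxMarginal; fun_prop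
  · unfold outMarginal; fun_prop

/-- Both informations contain `H(Q₀)` and `H(U,Q₀)`, which cancel; the terms still involving `U`
group letter by letter. Only the sum of the pieces and the sum of their gaps matter, which is what
makes convexity applicable. -/
theorem rateExpr_mul_log {pQ : Q₀ × Q₁ → ℝ} (hpQ : ∀ q, 0 ≤ pQ q)
    {p : S → Q₀ × Q₁ → X → ℝ} (hp : ∀ s q, p s q ∈ stdSimplex ℝ X)
    {r : Q₀ × Q₁ → U × S → ℝ} (hr : ∀ q u, 0 ≤ r q u) :
    rateExpr pQ p r * Real.log 2 = ∑ u, entropyGap p (fun z => pQ z.2 * r z.2 (u, z.1)) -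
      entropyGap p (fun z => ∑ u, pQ z.2 * r z.2 (u, z.1)) := by
  have hJ : ∀ u s q x, 0 ≤ jointLaw pQ p r u s q x := fun u s q x =>
    mul_nonneg (mul_nonneg (hpQ q) (hr _ _)) ((hp s q).1 x)
  have hx : ∀ u s q, ∑ x, jointLaw pQ p r u s q x = pQ q * r q (u, s) := fun u s q => by
    simp only [jointLaw]
    rw [← Finset.mul_sum, (hp s q).2, mul_one]
  rw [rateExpr, sub_mul, condMutualInfo_mul_log _ fun _ _ _ =>
      Finset.sum_nonneg fun _ _ => Finset.sum_nonneg fun _ _ => hJ _ _ _ _,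
    condMutualInfo_mul_log _ fun _ _ _ =>
      Finset.sum_nonneg fun _ _ => Finset.sum_nonneg fun _ _ => hJ _ _ _ _]
  simp only [hx]
  have a1 : ∀ u q₀, ∑ x, ∑ s, ∑ q₁, jointLaw pQ p r u s (q₀, q₁) x =
      ∑ q₁, ∑ s, pQ (q₀, q₁) * r (q₀, q₁) (u, s) := by
    intro u q₀
    rw [Finset.sum_comm, Finset.sum_comm (s := (Finset.univ : Finset Q₁))]
    refine Finset.sum_congr rfl fun s _ => ?_
    rw [Finset.sum_comm]
    simp only [hx]
  simp only [a1]
  have swap : ∀ f : Q₀ × Q₁ → ℝ, entropy (fun z : Q₁ × Q₀ => f (z.2, z.1)) = entropy f := by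
    intro f
    simp only [entropy, Fintype.sum_prod_type]
    rw [Finset.sum_comm]
  have b1 : ∀ u, entropy (fun z : Q₁ × Q₀ => ∑ s, pQ (z.2, z.1) * r (z.2, z.1) (u, s)) =
      entropy (ctxMarginal fun z : S × (Q₀ × Q₁) => pQ z.2 * r z.2 (u, z.1)) := fun u =>
    swap fun q => ∑ s, pQ q * r q (u, s)
  have b2 : entropy (fun z : Q₁ × Q₀ => ∑ u, ∑ s, pQ (z.2, z.1) * r (z.2, z.1) (u, s)) =
      entropy (ctxMarginal fun z : S × (Q₀ × Q₁) => ∑ u, pQ z.2 * r z.2 (u, z.1)) := by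
    rw [swap fun q => ∑ u, ∑ s, pQ q * r q (u, s)]
    congr 1
    ext q
    simp only [ctxMarginal]
    rw [Finset.sum_comm]
  have b3 : (fun z : X × Q₀ => ∑ u, ∑ s, ∑ q₁, jointLaw pQ p r u s (z.2, q₁) z.1) =
      outMarginal p fun z : S × (Q₀ × Q₁) => ∑ u, pQ z.2 * r z.2 (u, z.1) := by
    ext z
    simp only [outMarginal, jointLaw, Finset.sum_mul]
    rw [Finset.sum_comm]
    refine Finset.sum_congr rfl fun s _ => ?_
    rw [Finset.sum_comm]
  rw [b2, b3]
  simp only [b1, entropyGap, Finset.sum_sub_distrib]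
  have b4 : ∀ u, (fun z : X × Q₀ => ∑ s, ∑ q₁, jointLaw pQ p r u s (z.2, q₁) z.1) =
      outMarginal p fun z : S × (Q₀ × Q₁) => pQ z.2 * r z.2 (u, z.1) := fun u => rfl
  simp only [b4]
  ring

/-- Every joint mass function with first marginal `m` disintegrates along `m`. -/
theorem exists_kernel {α β : Type*} [Fintype α] [Nonempty α] (m : β → ℝ) (J : β → α → ℝ)
    (hJ : ∀ b a, 0 ≤ J b a) (hm : ∀ b, ∑ a, J b a = m b) :
    ∃ r : β → α → ℝ, (∀ b, r b ∈ stdSimplex ℝ α) ∧ ∀ b a, m b * r b a = J b a := by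
  classical
  obtain ⟨a₀⟩ := ‹Nonempty α›
  -- Where `m b = 0` the whole row of `J` vanishes, so any p.m.f. serves.
  refine ⟨fun b => if m b = 0 then Pi.single a₀ 1 else fun a => J b a / m b, fun b => ?_,
    fun b a => ?_⟩
  · dsimp only
    split_ifs with h
    · exact single_mem_stdSimplex ℝ a₀
    · refine ⟨fun a => div_nonneg (hJ b a) ?_, ?_⟩
      · rw [← hm]; exact Finset.sum_nonneg fun _ _ => hJ _ _
      · rw [← Finset.sum_div, hm, div_self h]
  · dsimp only
    split_ifs with h
    · have := (Finset.sum_eq_zero_iff_of_nonneg fun a _ => hJ b a).1 ((hm b).trans h) a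
        (Finset.mem_univ a)
      rw [this, h, zero_mul]
    · field_simp

theorem sum_sum_kernel {Q₀ Q₁ S U : Type*} [Fintype S] [Fintype U] {pQ : Q₀ × Q₁ → ℝ}
    {r : Q₀ × Q₁ → U × S → ℝ}
    (hr : ∀ q, r q ∈ stdSimplex ℝ (U × S)) (q : Q₀ × Q₁) :
    ∑ s, ∑ u, pQ q * r q (u, s) = pQ q := by
  simp only [← Finset.mul_sum]
  rw [Finset.sum_comm, ← Fintype.sum_prod_type, (hr q).2, mul_one]

/-- The single-letter rate expression attains its maximum over all finite auxiliary alphabets. -/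
theorem exists_max_rateExpr [Nonempty S] {pQ : Q₀ × Q₁ → ℝ} (hpQ : pQ ∈ stdSimplex ℝ (Q₀ × Q₁))
    {p : S → Q₀ × Q₁ → X → ℝ} (hp : ∀ s q, p s q ∈ stdSimplex ℝ X) :
    ∃ (k : ℕ) (r : Q₀ × Q₁ → Fin k × S → ℝ), (∀ q, r q ∈ stdSimplex ℝ (Fin k × S)) ∧
      ∀ (l : ℕ) (r' : Q₀ × Q₁ → Fin l × S → ℝ), (∀ q, r' q ∈ stdSimplex ℝ (Fin l × S)) →
        rateExpr pQ p r' ≤ rateExpr pQ p r := by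
  classical
  have hlog : 0 < Real.log 2 := Real.log_pos one_lt_two
  set K := stdSimplex ℝ (S × (Q₀ × Q₁))
  set gr : (S × (Q₀ × Q₁) → ℝ) → (S × (Q₀ × Q₁) → ℝ) × ℝ := fun ν => (ν, entropyGap p ν)
  have hgr : Continuous gr := continuous_id.prodMk (continuous_entropyGap p)
  set A := convexHull ℝ (gr '' K)
  have hA : IsCompact A :=
    isCompact_convexHull_of_finiteDimensional ((isCompact_stdSimplex ℝ _).image hgr)
  set F := {a : (S × (Q₀ × Q₁) → ℝ) × ℝ | ctxMarginal a.1 = pQ}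
  have hF : IsClosed F := by
    refine isClosed_eq ?_ continuous_const
    unfold ctxMarginal; fun_prop
  have hAF : IsCompact (A ∩ F) := hA.inter_right hF
  -- Normalise each piece: its total mass becomes the convex weight, and homogeneity carries the
  -- entropy gap along. `exists_kernel` also covers pieces of mass zero.
  have mass : ∀ (l : ℕ) (r' : Q₀ × Q₁ → Fin l × S → ℝ),
      (∀ q, r' q ∈ stdSimplex ℝ (Fin l × S)) →
      ((fun z => ∑ u, pQ z.2 * r' z.2 (u, z.1)),
        ∑ u, entropyGap p fun z => pQ z.2 * r' z.2 (u, z.1)) ∈ A ∩ F := by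
    intro l r' hr'
    refine ⟨?_, ?_⟩
    · set m : Fin l → S × (Q₀ × Q₁) → ℝ := fun u z => pQ z.2 * r' z.2 (u, z.1)
      have hm : ∀ u z, 0 ≤ m u z := fun u z => mul_nonneg (hpQ.1 _) ((hr' _).1 _)
      obtain ⟨n, hn, hmn⟩ : ∃ n : Fin l → S × (Q₀ × Q₁) → ℝ, (∀ u, n u ∈ K) ∧
          ∀ u z, (∑ z, m u z) * n u z = m u z := by
        have : Nonempty (S × (Q₀ × Q₁)) := by
          by_contra h
          rw [not_nonempty_iff] at h
          have : IsEmpty (Q₀ × Q₁) := ⟨fun q => h.false (Classical.arbitrary S, q)⟩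
          simpa using hpQ.2
        exact exists_kernel _ m hm fun u => rfl
      have hmn' : ∀ u, (∑ z, m u z) • n u = m u := fun u => by
        ext z; simpa using hmn u z
      have hmem := (convex_convexHull ℝ (gr '' K)).sum_mem (t := Finset.univ)
        (w := fun u => ∑ z, m u z) (z := fun u => gr (n u))
        (fun u _ => Finset.sum_nonneg fun z _ => hm u z) ?_
        (fun u _ => subset_convexHull ℝ _ (Set.mem_image_of_mem gr (hn u)))
      · convert hmem using 1
        have h1 : ∀ u, (∑ z, m u z) • gr (n u) = gr (m u) := by
          intro u
          refine Prod.ext (hmn' u) ?_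
          change (∑ z, m u z) * entropyGap p (n u) = entropyGap p (m u)
          rw [← entropyGap_smul hp, hmn']
        rw [Finset.sum_congr rfl fun u _ => h1 u]
        refine Prod.ext ?_ ?_
        · rw [Prod.fst_sum]; ext z; simp [gr, m]
        · rw [Prod.snd_sum]
      · rw [Finset.sum_comm, Fintype.sum_prod_type, Finset.sum_comm]
        rw [← hpQ.2]
        exact Finset.sum_congr rfl fun q _ => sum_sum_kernel hr' q
    · ext q
      exact sum_sum_kernel hr' q
  have hne : (A ∩ F).Nonempty := by
    refine ⟨_, mass 1 (fun _ => Pi.single (0, Classical.arbitrary S) 1) fun q => ?_⟩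
    exact single_mem_stdSimplex ℝ _
  obtain ⟨⟨ν, v⟩, ⟨haA, haF⟩, hmax⟩ := hAF.exists_isMaxOn hne
    (f := fun a => a.2 - entropyGap p a.1)
    ((continuous_snd.sub ((continuous_entropyGap p).comp continuous_fst)).continuousOn)
  obtain ⟨ι, _, w, z, hw0, hw1, hz, hsum⟩ := mem_convexHull_iff_exists_fintype.1 haA
  choose n hnK hnz using hz
  set k := Fintype.card ι
  let e : Fin k ≃ ι := (Fintype.equivFin ι).symm
  have hne' : Nonempty (Fin k) := by
    by_contra h
    rw [not_nonempty_iff] at h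
    have : IsEmpty ι := ⟨fun i => h.false (e.symm i)⟩
    simp at hw1
  have hν : ∀ y, ∑ u, w (e u) * n (e u) y = ν y := by
    intro y
    have := congrArg (fun a => a.1 y) hsum
    simp only [Prod.fst_sum, Finset.sum_apply] at this
    rw [← this, ← Equiv.sum_comp e]
    refine Finset.sum_congr rfl fun u _ => ?_
    rw [← hnz]; rfl
  have hv : ∑ u, w (e u) * entropyGap p (n (e u)) = v := by
    have := congrArg (fun a => a.2) hsum
    simp only [Prod.snd_sum] at this
    rw [← this, ← Equiv.sum_comp e]
    refine Finset.sum_congr rfl fun u _ => ?_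
    rw [← hnz]; rfl
  obtain ⟨r, hr, hrJ⟩ := exists_kernel pQ
    (fun q (a : Fin k × S) => w (e a.1) * n (e a.1) (a.2, q))
    (fun q a => mul_nonneg (hw0 _) ((hnK _).1 _)) (fun q => by
      rw [Fintype.sum_prod_type, Finset.sum_comm]
      simp only [hν]
      exact congrFun haF q)
  refine ⟨k, r, hr, fun l r' hr' => ?_⟩
  refine le_of_mul_le_mul_right ?_ hlog
  rw [rateExpr_mul_log hpQ.1 hp fun q => (hr q).1, rateExpr_mul_log hpQ.1 hp fun q => (hr' q).1]
  refine (hmax (mass l r' hr')).trans (le_of_eq ?_)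
  simp only [hrJ, hν]
  congr 1
  rw [← hv]
  refine Finset.sum_congr rfl fun u _ => ?_
  rw [← entropyGap_smul hp]
  rfl

end

/-! ### Entropy of random variables on a finite sample space -/

section

variable {Ω α β : Type*} [Fintype Ω]

open Classical in
/-- The mass function of the random variable `f` when the sample space carries the masses `P`. -/
noncomputable def law (P : Ω → ℝ) (f : Ω → α) (a : α) : ℝ := ∑ ω, if f ω = a then P ω else 0

/-- Entropy in nats of the random variable `f`, as an expectation over the sample space. -/
noncomputable def entropyOf (P : Ω → ℝ) (f : Ω → α) : ℝ := -∑ ω, P ω * Real.log (law P f (f ω))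

theorem law_nonneg {P : Ω → ℝ} (hP : ∀ ω, 0 ≤ P ω) (f : Ω → α) (a : α) : 0 ≤ law P f a :=
  Finset.sum_nonneg fun ω _ => by split_ifs <;> simp [hP]

theorem le_law {P : Ω → ℝ} (hP : ∀ ω, 0 ≤ P ω) (f : Ω → α) (ω : Ω) : P ω ≤ law P f (f ω) := by
  classical
  refine le_trans (by simp) (Finset.single_le_sum (f := fun ω' => if f ω' = f ω then P ω' else 0)
    (fun ω' _ => by split_ifs <;> simp [hP]) (Finset.mem_univ ω)) |>.trans (le_of_eq ?_)
  exact Finset.sum_congr rfl fun _ _ => by congr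

theorem sum_law_mul [Fintype α] (P : Ω → ℝ) (f : Ω → α) (g : α → ℝ) :
    ∑ a, law P f a * g a = ∑ ω, P ω * g (f ω) := by
  classical
  simp only [law, Finset.sum_mul]
  rw [Finset.sum_comm]
  refine Finset.sum_congr rfl fun ω _ => ?_
  rw [Finset.sum_eq_single (f ω)] <;> simp +contextual [eq_comm]

theorem sum_law [Fintype α] (P : Ω → ℝ) (f : Ω → α) : ∑ a, law P f a = ∑ ω, P ω := by
  simpa using sum_law_mul P f fun _ => 1

theorem entropy_law [Fintype α] (P : Ω → ℝ) (f : Ω → α) : entropy (law P f) = entropyOf P f := by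
  simp only [entropy, Real.negMulLog, entropyOf, neg_mul, Finset.sum_neg_distrib]
  rw [sum_law_mul P f fun a => Real.log (law P f a)]

/-- Entropy sees only the partition into fibres, so variables carrying the same information are
exchanged without building a bijection between their ranges. -/
theorem entropyOf_congr (P : Ω → ℝ) {f : Ω → α} {g : Ω → β}
    (h : ∀ ω ω', f ω = f ω' ↔ g ω = g ω') : entropyOf P f = entropyOf P g := by
  classical
  have hl : ∀ ω, law P f (f ω) = law P g (g ω) := fun ω =>
    Finset.sum_congr rfl fun ω' _ => if_congr (h ω' ω) rfl rfl
  simp only [entropyOf, hl]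

/-- The entropy is at most the cross entropy relative to a sub-probability mass function. -/
theorem entropyOf_le_crossEntropy [Fintype α] {P : Ω → ℝ} (hP : ∀ ω, 0 ≤ P ω) (hP1 : ∑ ω, P ω = 1)
    (f : Ω → α) {g : α → ℝ} (hg : ∀ a, 0 ≤ g a) (hg1 : ∑ a, g a ≤ 1)
    (hpos : ∀ ω, 0 < P ω → 0 < g (f ω)) :
    entropyOf P f ≤ -∑ ω, P ω * Real.log (g (f ω)) := by
  -- Gibbs' inequality from `log y ≤ y - 1` with `y = g / law`.
  have h1 : ∀ ω, P ω * Real.log (g (f ω)) - P ω * Real.log (law P f (f ω)) ≤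
      P ω * (g (f ω) / law P f (f ω)) - P ω := by
    intro ω
    rcases (hP ω).eq_or_lt with h | h
    · simp [← h]
    have hl := h.trans_le (le_law hP f ω)
    rw [← mul_sub, ← Real.log_div (hpos ω h).ne' hl.ne']
    nlinarith [Real.log_le_sub_one_of_pos (div_pos (hpos ω h) hl)]
  have h2 : ∑ ω, P ω * (g (f ω) / law P f (f ω)) ≤ 1 := by
    rw [← sum_law_mul P f fun a => g a / law P f a]
    refine (Finset.sum_le_sum fun a _ => ?_).trans hg1
    rcases (law_nonneg hP f a).eq_or_lt with h | h
    · simpa [← h] using hg a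
    · exact (mul_div_cancel₀ _ h.ne').le
  have h3 := Finset.sum_le_sum fun ω (_ : ω ∈ Finset.univ) => h1 ω
  rw [Finset.sum_sub_distrib, Finset.sum_sub_distrib, hP1] at h3
  rw [entropyOf]
  linarith

end

/-! ### The rate bound on a sample space, and independence under product laws -/

section

variable {Q₀ Q₁ S X : Type*} [Fintype Q₀] [Fintype Q₁] [Fintype S] [Fintype X]
variable {Ω : Type*} [Fintype Ω]

/-- The bound on the rate expression for auxiliary variables living on an arbitrary sample space. -/
theorem entropyOf_le_of_rateExpr_le [Nonempty S] {pQ : Q₀ × Q₁ → ℝ} (hpQ : ∀ q, 0 ≤ pQ q)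
    {p : S → Q₀ × Q₁ → X → ℝ} (hp : ∀ s q, p s q ∈ stdSimplex ℝ X) {C : ℝ}
    (hC : ∀ (k : ℕ) (r : Q₀ × Q₁ → Fin k × S → ℝ),
      (∀ q, r q ∈ stdSimplex ℝ (Fin k × S)) → rateExpr pQ p r ≤ C)
    {P : Ω → ℝ} (hP : ∀ ω, 0 ≤ P ω) [Nonempty Ω] {𝒰 : Type*} [Fintype 𝒰]
    (U : Ω → 𝒰) (T : Ω → S) (Q : Ω → Q₀ × Q₁) (Y : Ω → X) (hQ : law P Q = pQ)
    (hY : ∀ u s q x, law P (fun ω => (U ω, T ω, Q ω, Y ω)) (u, s, q, x) =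
      law P (fun ω => (U ω, T ω, Q ω)) (u, s, q) * p s q x) :
    entropyOf P (fun ω => (U ω, Q ω)) - entropyOf P (fun ω => (U ω, Y ω, (Q ω).1))
      - entropyOf P Q + entropyOf P (fun ω => (Y ω, (Q ω).1)) ≤ C * Real.log 2 := by
  classical
  have : Nonempty 𝒰 := ⟨U (Classical.arbitrary Ω)⟩
  set e := Fintype.equivFin 𝒰
  set k := Fintype.card 𝒰
  have : Nonempty (Fin k) := ⟨e (Classical.arbitrary 𝒰)⟩
  -- The hypothesis speaks of alphabets `Fin k`, so `𝒰` is relabelled; `r` is the conditional law of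
  -- `(U, T)` given `Q`.
  obtain ⟨r, hr, hrJ⟩ := exists_kernel pQ
    (fun q (a : Fin k × S) => law P (fun ω => (U ω, T ω, Q ω)) (e.symm a.1, a.2, q))
    (fun q a => law_nonneg hP _ _) (fun q => by
      rw [← hQ, Fintype.sum_prod_type,
        Equiv.sum_comp e.symm fun u => ∑ s, law P (fun ω => (U ω, T ω, Q ω)) (u, s, q)]
      simp only [law, Prod.mk.injEq]
      rw [Finset.sum_congr rfl fun s _ => Finset.sum_comm, Finset.sum_comm]
      refine Finset.sum_congr rfl fun ω _ => ?_
      simp [ite_and])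
  have h := mul_le_mul_of_nonneg_right (hC k r hr) (Real.log_pos one_lt_two).le
  refine le_trans (le_of_eq ?_) h
  rw [rateExpr_mul_log hpQ hp fun q => (hr q).1]
  simp only [hrJ]
  rw [Equiv.sum_comp e.symm fun u => entropyGap p fun z : S × (Q₀ × Q₁) =>
      law P (fun ω => (U ω, T ω, Q ω)) (u, z.1, z.2)]
  have t : (fun z : S × (Q₀ × Q₁) => ∑ u, law P (fun ω => (U ω, T ω, Q ω)) (e.symm u, z.1, z.2)) =
      law P fun ω => (T ω, Q ω) := by
    ext z
    rw [Equiv.sum_comp e.symm fun u => law P (fun ω => (U ω, T ω, Q ω)) (u, z.1, z.2)]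
    simp only [law]
    rw [Finset.sum_comm]
    refine Finset.sum_congr rfl fun ω _ => ?_
    simp [ite_and, Prod.ext_iff]
  rw [t]
  simp only [entropyGap, Finset.sum_sub_distrib]
  have c1 : ∀ u, ctxMarginal (fun z : S × (Q₀ × Q₁) =>
      law P (fun ω => (U ω, T ω, Q ω)) (u, z.1, z.2)) =
      fun q => law P (fun ω => (U ω, Q ω)) (u, q) := by
    intro u
    ext q
    simp only [ctxMarginal, law]
    rw [Finset.sum_comm]
    refine Finset.sum_congr rfl fun ω _ => ?_
    simp [ite_and]
  have c2 : ctxMarginal (law P fun ω => (T ω, Q ω)) = law P Q := by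
    ext q
    simp only [ctxMarginal, law]
    rw [Finset.sum_comm]
    refine Finset.sum_congr rfl fun ω _ => ?_
    simp [ite_and]
  have c3 : ∀ u, outMarginal p (fun z : S × (Q₀ × Q₁) =>
      law P (fun ω => (U ω, T ω, Q ω)) (u, z.1, z.2)) =
      fun z => law P (fun ω => (U ω, Y ω, (Q ω).1)) (u, z) := by
    intro u
    ext z
    simp only [outMarginal, ← hY]
    simp only [law]
    rw [Finset.sum_congr rfl fun s _ => Finset.sum_comm, Finset.sum_comm]
    refine Finset.sum_congr rfl fun ω _ => ?_
    simp only [Prod.ext_iff]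
    by_cases h1 : U ω = u <;> by_cases h2 : Y ω = z.1 <;> by_cases h3 : (Q ω).1 = z.2 <;>
      simp [h1, h2, h3, ite_and]
  have c4 : outMarginal p (law P fun ω => (T ω, Q ω)) = law P fun ω => (Y ω, (Q ω).1) := by
    have : law P (fun ω => (T ω, Q ω)) = fun z : S × (Q₀ × Q₁) => ∑ u,
        law P (fun ω => (U ω, T ω, Q ω)) (u, z.1, z.2) := by
      rw [← t]
      ext z
      rw [Equiv.sum_comp e.symm fun u => law P (fun ω => (U ω, T ω, Q ω)) (u, z.1, z.2)]
    have h5 : outMarginal p (law P fun ω => (T ω, Q ω)) = fun z => ∑ u, outMarginal p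
        (fun z : S × (Q₀ × Q₁) => law P (fun ω => (U ω, T ω, Q ω)) (u, z.1, z.2)) z := by
      rw [this]
      ext z
      simp only [outMarginal, Finset.sum_mul]
      rw [Finset.sum_congr rfl fun s _ => Finset.sum_comm, Finset.sum_comm]
    rw [h5]
    ext z
    simp only [c3]
    simp only [law]
    rw [Finset.sum_comm]
    refine Finset.sum_congr rfl fun ω _ => ?_
    simp [ite_and, Prod.ext_iff]
  simp only [c1, c3]
  rw [c2, c4, ← entropy_law, ← entropy_law, ← entropy_law, ← entropy_law,
    entropy_prod (law P fun ω => (U ω, Q ω)),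
    entropy_prod (law P fun ω => (U ω, Y ω, (Q ω).1))]
  ring

/-- Under a product mass function, coordinate `i` is independent of every function that does not
depend on it. -/
theorem sum_prod_mul_ite {ι α : Type*} [Fintype ι] [DecidableEq ι] [Fintype α] [DecidableEq α]
    (m : ι → α → ℝ) (i : ι) (hm : ∑ a, m i a = 1) (g : (ι → α) → ℝ)
    (hg : ∀ x x' : ι → α, (∀ j, j ≠ i → x j = x' j) → g x = g x') (b : α) :
    ∑ x : ι → α, (∏ j, m j (x j)) * (if x i = b then g x else 0) =
      m i b * ∑ x : ι → α, (∏ j, m j (x j)) * g x := by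
  have key : ∀ h : (ι → α) → ℝ, ∑ x : ι → α, (∏ j, m j (x j)) * h x =
      ∑ a, ∑ y : {j // j ≠ i} → α, m i a * (∏ j : {j // j ≠ i}, m j (y j)) *
        h ((Equiv.funSplitAt i α).symm (a, y)) := by
    intro h
    rw [← Equiv.sum_comp (Equiv.funSplitAt i α).symm, Fintype.sum_prod_type]
    refine Finset.sum_congr rfl fun a _ => Finset.sum_congr rfl fun y _ => ?_
    rw [Fintype.prod_eq_mul_prod_subtype_ne _ i]
    congr 2
    · simp
    · refine Finset.prod_congr rfl fun j _ => ?_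
      simp [j.2]
  rw [key, key]
  have hg' : ∀ a y, g ((Equiv.funSplitAt i α).symm (a, y)) =
      g ((Equiv.funSplitAt i α).symm (b, y)) := fun a y =>
    hg _ _ fun j hj => by simp [hj]
  simp only [fun a y => hg' a y]
  have : ∀ a, ∑ y : {j // j ≠ i} → α, m i a * (∏ j : {j // j ≠ i}, m j (y j)) *
      g ((Equiv.funSplitAt i α).symm (b, y)) = m i a * ∑ y : {j // j ≠ i} → α,
        (∏ j : {j // j ≠ i}, m j (y j)) * g ((Equiv.funSplitAt i α).symm (b, y)) := by
    intro a
    rw [Finset.mul_sum]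
    exact Finset.sum_congr rfl fun _ _ => mul_assoc _ _ _
  simp only [this, ← Finset.sum_mul, hm, one_mul]
  rw [Finset.sum_eq_single b]
  · simp [this]
  · intro a _ hab
    refine Finset.sum_eq_zero fun y _ => ?_
    simp [hab]
  · simp

theorem sum_prod_eq_one {ι α : Type*} [Fintype ι] [DecidableEq ι] [Fintype α]
    {m : ι → α → ℝ} (hm : ∀ i, ∑ a, m i a = 1) : ∑ x : ι → α, ∏ j, m j (x j) = 1 := by
  rw [← Fintype.prod_sum]
  simp [hm]

end

/-! ### The converse -/

section

variable {Q₀ Q₁ S X : Type*} [Fintype Q₀] [Fintype Q₁] [Fintype X]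

/-- The joint mass function of semantic, context sequence and message codeword under a code. -/
noncomputable def codeLaw (pQ : Q₀ × Q₁ → ℝ) (p : S → Q₀ × Q₁ → X → ℝ) {n M : ℕ}
    (c : Code Q₀ Q₁ S X n M) (ω : Fin M × (Fin n → Q₀ × Q₁) × (Fin n → X)) : ℝ :=
  (1 / (M : ℝ)) * ((∏ i, pQ (ω.2.1 i)) * ∏ i, p (c.enc ω.1 ω.2.1 i) (ω.2.1 i) (ω.2.2 i))

variable {pQ : Q₀ × Q₁ → ℝ} {p : S → Q₀ × Q₁ → X → ℝ} {n M : ℕ}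

omit [Fintype Q₀] [Fintype Q₁] in
theorem codeLaw_nonneg (hpQ : ∀ q, 0 ≤ pQ q) (hp : ∀ s q, p s q ∈ stdSimplex ℝ X)
    (c : Code Q₀ Q₁ S X n M) (ω) : 0 ≤ codeLaw pQ p c ω :=
  mul_nonneg (by positivity) (mul_nonneg (Finset.prod_nonneg fun _ _ => hpQ _)
    (Finset.prod_nonneg fun _ _ => (hp _ _).1 _))

theorem sum_codeLaw_mul (hp : ∀ s q, p s q ∈ stdSimplex ℝ X)
    (c : Code Q₀ Q₁ S X n M) (g : Fin M × (Fin n → Q₀ × Q₁) → ℝ) :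
    ∑ ω, codeLaw pQ p c ω * g (ω.1, ω.2.1) =
      ∑ w, ∑ q, (1 / (M : ℝ)) * (∏ i, pQ (q i)) * g (w, q) := by
  classical
  simp only [Fintype.sum_prod_type, codeLaw]
  refine Finset.sum_congr rfl fun w _ => Finset.sum_congr rfl fun q _ => ?_
  rw [← Finset.sum_mul, ← Finset.mul_sum, ← Finset.mul_sum, sum_prod_eq_one fun i => (hp _ _).2,
    mul_one]

theorem sum_codeLaw (hpQ : pQ ∈ stdSimplex ℝ (Q₀ × Q₁)) (hp : ∀ s q, p s q ∈ stdSimplex ℝ X)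
    (hM : 0 < M) (c : Code Q₀ Q₁ S X n M) : ∑ ω, codeLaw pQ p c ω = 1 := by
  classical
  have h := sum_codeLaw_mul (pQ := pQ) hp c fun _ => 1
  simp only [mul_one, ← Finset.mul_sum] at h
  rw [h, sum_prod_eq_one fun i => hpQ.2]
  have : (M : ℝ) ≠ 0 := by positivity
  simp [this]

theorem errorProb_eq_sum_codeLaw (c : Code Q₀ Q₁ S X n M) :
    errorProb pQ p c = ∑ ω, codeLaw pQ p c ω *
      (if c.dec ω.2.2 (fun i => (ω.2.1 i).1) = ω.1 then 0 else 1) := by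
  simp only [errorProb, Fintype.sum_prod_type, codeLaw, Finset.mul_sum]
  refine Finset.sum_congr rfl fun w _ => Finset.sum_congr rfl fun q _ =>
    Finset.sum_congr rfl fun x _ => ?_
  ring

theorem law_context (hpQ : pQ ∈ stdSimplex ℝ (Q₀ × Q₁)) (hp : ∀ s q, p s q ∈ stdSimplex ℝ X)
    (hM : 0 < M) (c : Code Q₀ Q₁ S X n M) (i : Fin n) :
    law (codeLaw pQ p c) (fun ω => ω.2.1 i) = pQ := by
  classical
  ext a
  have h := sum_codeLaw_mul (pQ := pQ) hp c fun z => if z.2 i = a then 1 else 0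
  simp only [law]
  have hM' : (M : ℝ) ≠ 0 := by positivity
  calc _ = ∑ ω, codeLaw pQ p c ω * (if ω.2.1 i = a then 1 else 0) :=
        Finset.sum_congr rfl fun ω _ => by split_ifs <;> simp
    _ = _ := h
    _ = pQ a := by
      simp only [mul_assoc, ← Finset.mul_sum]
      have h5 := sum_prod_mul_ite (fun _ => pQ) i hpQ.2 (fun _ => 1) (fun _ _ _ => rfl) a
      simp only [mul_one] at h5
      rw [sum_prod_eq_one fun _ => hpQ.2, mul_one] at h5
      trans (1 / (M : ℝ)) * ∑ _w : Fin M, pQ a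
      · congr 1
        refine Finset.sum_congr rfl fun w _ => ?_
        convert h5
      · simp [hM']

/-- This is the Markov chain `U → (S_i, Q_i) → X_i`. The channel is memoryless and used without
feedback, so for fixed `w` and contexts `X_i` is independent of the other outputs, and `U` sees only
those. -/
theorem law_output (hp : ∀ s q, p s q ∈ stdSimplex ℝ X)
    (c : Code Q₀ Q₁ S X n M) (i : Fin n) {𝒰 : Type*}
    (U : Fin M × (Fin n → Q₀ × Q₁) × (Fin n → X) → 𝒰)
    (hU : ∀ w q x x', (∀ j, j ≠ i → x j = x' j) → U (w, q, x) = U (w, q, x'))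
    (u : 𝒰) (s : S) (q : Q₀ × Q₁) (x : X) :
    law (codeLaw pQ p c) (fun ω => (U ω, c.enc ω.1 ω.2.1 i, ω.2.1 i, ω.2.2 i)) (u, s, q, x) =
      law (codeLaw pQ p c) (fun ω => (U ω, c.enc ω.1 ω.2.1 i, ω.2.1 i)) (u, s, q) * p s q x := by
  classical
  simp only [law, Fintype.sum_prod_type, codeLaw, Finset.sum_mul]
  refine Finset.sum_congr rfl fun w _ => Finset.sum_congr rfl fun q' _ => ?_
  have h := sum_prod_mul_ite (fun j => p (c.enc w q' j) (q' j)) i (hp _ _).2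
    (fun y => if (U (w, q', y), c.enc w q' i, q' i) = (u, s, q) then (1 : ℝ) else 0)
    (fun y y' hy => by simp only [hU w q' y y' hy]) x
  have h2 := congrArg (fun t => (1 / (M : ℝ)) * (∏ i, pQ (q' i)) * t) h
  simp only [Finset.mul_sum] at h2
  calc _ = _ := Finset.sum_congr rfl fun y _ => ?_
    _ = _ := h2
    _ = _ := Finset.sum_congr rfl fun y _ => ?_
  · by_cases h1 : U (w, q', y) = u <;> by_cases h2 : c.enc w q' i = s <;>
      by_cases h3 : q' i = q <;> by_cases h4 : y i = x <;> simp [h1, h2, h3, h4, mul_assoc]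
  · by_cases h1 : U (w, q', y) = u <;> by_cases h2 : c.enc w q' i = s <;>
      by_cases h3 : q' i = q <;> (simp [h1, h2, h3]; try ring)

/-- The semantic, the receiver's context, the outputs before time `i` and the sender's private
context from time `i` on. -/
def mixedView (i : ℕ) (ω : Fin M × (Fin n → Q₀ × Q₁) × (Fin n → X)) :
    Fin M × (Fin n → Q₀) × (Fin n → X ⊕ Q₁) :=
  (ω.1, fun j => (ω.2.1 j).1, fun j => if j.val < i then .inl (ω.2.2 j) else .inr (ω.2.1 j).2)

/-- The auxiliary variable of the converse: the semantic, the receiver's context, the outputs before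
time `i` and the sender's private context after time `i`. -/
def auxView (i : Fin n) (ω : Fin M × (Fin n → Q₀ × Q₁) × (Fin n → X)) :
    Fin M × (Fin n → Q₀) × (Fin n → Option (X ⊕ Q₁)) :=
  (ω.1, fun j => (ω.2.1 j).1, fun j => if j < i then some (.inl (ω.2.2 j)) else
    if j = i then none else some (.inr (ω.2.1 j).2))

/-- Before any replacement the view amounts to `(W, Qⁿ)`, whose law is the uniform one times a
product, so the logarithm is additive. -/
theorem entropyOf_mixedView_zero (hpQ : pQ ∈ stdSimplex ℝ (Q₀ × Q₁))
    (hp : ∀ s q, p s q ∈ stdSimplex ℝ X) (hM : 0 < M) (c : Code Q₀ Q₁ S X n M) :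
    entropyOf (codeLaw pQ p c) (mixedView 0) = Real.log M +
      ∑ i, entropyOf (codeLaw pQ p c) fun ω => ω.2.1 i := by
  classical
  have hM' : (0 : ℝ) < M := by positivity
  have h1 : entropyOf (codeLaw pQ p c) (mixedView 0) =
      entropyOf (codeLaw pQ p c) fun ω => (ω.1, ω.2.1) := by
    refine entropyOf_congr _ fun ω ω' => ?_
    simp only [mixedView, funext_iff, Nat.not_lt_zero, if_false, Sum.inr.injEq,
      Prod.ext_iff, forall_and]
  have h2 : ∀ ω : Fin M × (Fin n → Q₀ × Q₁) × (Fin n → X),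
      law (codeLaw pQ p c) (fun ω => (ω.1, ω.2.1)) (ω.1, ω.2.1) =
      (1 / (M : ℝ)) * ∏ i, pQ (ω.2.1 i) := by
    intro ω
    have h := sum_codeLaw_mul (pQ := pQ) hp c fun z => if z = (ω.1, ω.2.1) then 1 else 0
    calc _ = ∑ ω', codeLaw pQ p c ω' * (if (ω'.1, ω'.2.1) = (ω.1, ω.2.1) then 1 else 0) :=
          Finset.sum_congr rfl fun ω _ => by split_ifs <;> simp
      _ = _ := h
      _ = _ := by
        simp [Prod.ext_iff, ite_and]
  have h3 : ∀ ω, codeLaw pQ p c ω * Real.log ((1 / (M : ℝ)) * ∏ i, pQ (ω.2.1 i)) =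
      -(codeLaw pQ p c ω * Real.log M) + ∑ i, codeLaw pQ p c ω * Real.log (pQ (ω.2.1 i)) := by
    intro ω
    by_cases h : ∏ i, pQ (ω.2.1 i) = 0
    · have : codeLaw pQ p c ω = 0 := by rw [codeLaw, h]; simp
      simp [this]
    · rw [Real.log_mul (by positivity) h, Real.log_prod (Finset.prod_ne_zero_iff.1 h),
        one_div, Real.log_inv, ← Finset.mul_sum]
      ring
  rw [h1, entropyOf]
  simp only [h2, h3, Finset.sum_add_distrib, Finset.sum_neg_distrib, ← Finset.sum_mul,
    sum_codeLaw hpQ hp hM c]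
  rw [Finset.sum_comm]
  simp only [entropyOf, law_context hpQ hp hM c, Finset.sum_neg_distrib]
  ring

/-- Fano's inequality combined with subadditivity of entropy over the letters. -/
theorem entropyOf_mixedView_last_le (hpQ : pQ ∈ stdSimplex ℝ (Q₀ × Q₁))
    (hp : ∀ s q, p s q ∈ stdSimplex ℝ X) (hM : 0 < M) (c : Code Q₀ Q₁ S X n M) :
    entropyOf (codeLaw pQ p c) (mixedView n) ≤
      ∑ i, entropyOf (codeLaw pQ p c) (fun ω => (ω.2.2 i, (ω.2.1 i).1)) + Real.log 2 +
        errorProb pQ p c * Real.log M := by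
  classical
  have hM' : (0 : ℝ) < M := by positivity
  set P := codeLaw pQ p c
  have hP : ∀ ω, 0 ≤ P ω := codeLaw_nonneg hpQ.1 hp c
  have hP1 : ∑ ω, P ω = 1 := sum_codeLaw hpQ hp hM c
  set lz : Fin n → X × Q₀ → ℝ := fun i => law P fun ω => (ω.2.2 i, (ω.2.1 i).1)
  -- The comparison law: product of the letter marginals, then half of the mass on the decoded
  -- semantic and half spread uniformly. It costs `log 2` on correct decoding and `log (2M)` on
  -- error; the decoded value's uniform share is dropped, leaving total mass at most one.
  set g : Fin M × (Fin n → X × Q₀) → ℝ := fun a => (∏ i, lz i (a.2 i)) *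
    if c.dec (fun i => (a.2 i).1) (fun i => (a.2 i).2) = a.1 then (1 / 2 : ℝ) else 1 / (2 * M)
  have h1 : entropyOf P (mixedView n) =
      entropyOf P fun ω => (ω.1, fun i => (ω.2.2 i, (ω.2.1 i).1)) := by
    refine entropyOf_congr _ fun ω ω' => ?_
    simp only [mixedView, funext_iff, Fin.is_lt, if_true, Sum.inl.injEq,
      Prod.ext_iff, forall_and]
    tauto
  have hlz : ∀ i a, 0 ≤ lz i a := fun i a => law_nonneg hP _ _
  have hg1 : ∑ a, g a ≤ 1 := by
    rw [Fintype.sum_prod_type, Finset.sum_comm]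
    have : ∀ z : Fin n → X × Q₀, ∑ w, g (w, z) ≤ ∏ i, lz i (z i) := by
      intro z
      simp only [g]
      rw [← Finset.mul_sum]
      refine mul_le_of_le_one_right (Finset.prod_nonneg fun i _ => hlz _ _) ?_
      calc _ ≤ ∑ w : Fin M, ((if c.dec (fun i => (z i).1) (fun i => (z i).2) = w then 1 / 2 else 0)
            + 1 / (2 * (M : ℝ))) := by
            refine Finset.sum_le_sum fun w _ => ?_
            split_ifs
            · have : 0 ≤ 1 / (2 * (M : ℝ)) := by positivity
              linarith
            · simp
        _ = 1 := by
          rw [Finset.sum_add_distrib]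
          simp
          field_simp
          norm_num
    refine (Finset.sum_le_sum fun z _ => this z).trans (le_of_eq ?_)
    exact sum_prod_eq_one fun i => by rw [sum_law, hP1]
  have hpos : ∀ (ω : Fin M × (Fin n → Q₀ × Q₁) × (Fin n → X)), 0 < P ω →
      ∀ i, 0 < lz i (ω.2.2 i, (ω.2.1 i).1) := fun ω hω i =>
    hω.trans_le (le_law hP (fun ω => (ω.2.2 i, (ω.2.1 i).1)) ω)
  rw [h1]
  refine (entropyOf_le_crossEntropy hP hP1 _ (g := g) (fun a => mul_nonneg
    (Finset.prod_nonneg fun _ _ => hlz _ _) (by split_ifs <;> positivity)) hg1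
    (fun ω hω => mul_pos (Finset.prod_pos fun i _ => hpos ω hω i)
      (by split_ifs <;> positivity))).trans (le_of_eq ?_)
  have key : ∀ ω : Fin M × (Fin n → Q₀ × Q₁) × (Fin n → X),
      P ω * Real.log (g (ω.1, fun i => (ω.2.2 i, (ω.2.1 i).1))) =
      ∑ i, P ω * Real.log (lz i (ω.2.2 i, (ω.2.1 i).1)) - P ω * Real.log 2 -
        P ω * (if c.dec ω.2.2 (fun i => (ω.2.1 i).1) = ω.1 then 0 else 1) * Real.log M := by
    intro ω
    rcases (hP ω).eq_or_lt with h | h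
    · simp [← h]
    simp only [g]
    rw [Real.log_mul (Finset.prod_pos fun i _ => hpos ω h i).ne' (by split_ifs <;> positivity),
      Real.log_prod fun i _ => (hpos ω h i).ne', ← Finset.mul_sum]
    split_ifs
    · rw [one_div, Real.log_inv]; ring
    · rw [one_div, Real.log_inv, Real.log_mul two_ne_zero hM'.ne']; ring
  simp only [key, Finset.sum_sub_distrib, ← Finset.sum_mul, hP1, ← errorProb_eq_sum_codeLaw, P]
  rw [Finset.sum_comm]
  simp only [entropyOf, Finset.sum_neg_distrib, lz, P]
  ring

/-- The non-asymptotic converse. -/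
theorem log_le_of_rateExpr_le [Fintype S] [Nonempty S] (hpQ : pQ ∈ stdSimplex ℝ (Q₀ × Q₁))
    (hp : ∀ s q, p s q ∈ stdSimplex ℝ X) {C : ℝ}
    (hC : ∀ (k : ℕ) (r : Q₀ × Q₁ → Fin k × S → ℝ),
      (∀ q, r q ∈ stdSimplex ℝ (Fin k × S)) → rateExpr pQ p r ≤ C)
    (hM : 0 < M) (c : Code Q₀ Q₁ S X n M) :
    Real.log M ≤ n * (C * Real.log 2) + Real.log 2 + errorProb pQ p c * Real.log M := by
  classical
  set P := codeLaw pQ p c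
  have hP : ∀ ω, 0 ≤ P ω := codeLaw_nonneg hpQ.1 hp c
  have : Nonempty (Fin M × (Fin n → Q₀ × Q₁) × (Fin n → X)) := by
    by_contra h
    rw [not_nonempty_iff] at h
    simpa using sum_codeLaw hpQ hp hM c
  have step : ∀ i : Fin n, entropyOf P (mixedView i.val) - entropyOf P (mixedView (i.val + 1))
      - entropyOf P (fun ω => ω.2.1 i) + entropyOf P (fun ω => (ω.2.2 i, (ω.2.1 i).1)) ≤
        C * Real.log 2 := by
    intro i
    have h := entropyOf_le_of_rateExpr_le hpQ.1 hp hC hP (auxView i)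
      (fun ω => c.enc ω.1 ω.2.1 i) (fun ω => ω.2.1 i) (fun ω => ω.2.2 i)
      (law_context hpQ hp hM c i)
      (law_output hp c i (auxView i) fun w q x x' hx => by
        simp only [auxView, Prod.mk.injEq, true_and]
        funext j
        by_cases hj : j < i
        · simp [hj, hx j hj.ne]
        · simp [hj])
    -- Filling the hole of `auxView i` with the private context gives the hybrid at `i`; filling it
    -- with the output gives the one at `i + 1`.
    have e1 : entropyOf P (mixedView i.val) = entropyOf P fun ω => (auxView i ω, ω.2.1 i) := by
      refine entropyOf_congr _ fun ω ω' => ?_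
      simp only [mixedView, auxView, funext_iff, Prod.ext_iff, and_assoc]
      refine and_congr_right fun _ => and_congr_right fun h0 => ⟨fun h => ⟨fun j => ?_, h0 i, ?_⟩,
        fun h j => ?_⟩
      · have := h j
        grind
      · have := h i
        grind
      · have := h.1 j
        grind
    have e2 : entropyOf P (mixedView (i.val + 1)) =
        entropyOf P fun ω => (auxView i ω, ω.2.2 i, (ω.2.1 i).1) := by
      refine entropyOf_congr _ fun ω ω' => ?_
      simp only [mixedView, auxView, Prod.mk.injEq, funext_iff, and_assoc]
      refine and_congr_right fun _ => and_congr_right fun h0 => ⟨fun h => ⟨fun j => ?_, ?_, h0 i⟩,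
        fun h j => ?_⟩
      · have := h j
        grind
      · have := h i
        grind
      · have := h.1 j
        grind
    rw [e1, e2]
    exact h
  have hs := Finset.sum_le_sum fun i (_ : i ∈ Finset.univ) => step i
  have ht : ∑ i : Fin n, (entropyOf P (mixedView i.val) - entropyOf P (mixedView (i.val + 1))) =
      entropyOf P (mixedView 0) - entropyOf P (mixedView n) := by
    rw [Fin.sum_univ_eq_sum_range
      (fun i => entropyOf P (mixedView i) - entropyOf P (mixedView (i + 1))) n,
      Finset.sum_range_sub']
  rw [Finset.sum_add_distrib, Finset.sum_sub_distrib, ht, entropyOf_mixedView_zero hpQ hp hM c] at hs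
  have hl := entropyOf_mixedView_last_le hpQ hp hM c
  simp only [Finset.sum_const, Finset.card_univ, Fintype.card_fin, nsmul_eq_mul] at hs
  linarith

/-- Dividing the non-asymptotic bound by `n log 2` leaves `(1 - errorProb) R ≤ C + 1/n` as soon as
the error is at most one and `n > 0`; then let `n → ∞`. -/
theorem Achievable.le_of_rateExpr_le [Fintype S] [Nonempty S] (hpQ : pQ ∈ stdSimplex ℝ (Q₀ × Q₁))
    (hp : ∀ s q, p s q ∈ stdSimplex ℝ X) {C : ℝ}
    (hC : ∀ (k : ℕ) (r : Q₀ × Q₁ → Fin k × S → ℝ),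
      (∀ q, r q ∈ stdSimplex ℝ (Fin k × S)) → rateExpr pQ p r ≤ C)
    {R : ℝ} (hR : Achievable pQ p R) : R ≤ C := by
  obtain ⟨-, c, hc⟩ := hR
  have hlog : 0 < Real.log 2 := Real.log_pos one_lt_two
  have h1 : Tendsto (fun n => (1 - errorProb pQ p (c n)) * R) atTop (𝓝 ((1 - 0) * R)) :=
    (tendsto_const_nhds.sub hc).mul_const R
  have h2 : Tendsto (fun n : ℕ => C + 1 / (n : ℝ)) atTop (𝓝 (C + 0)) :=
    tendsto_const_nhds.add tendsto_one_div_atTop_nhds_zero_nat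
  rw [sub_zero, one_mul] at h1
  rw [add_zero] at h2
  refine le_of_tendsto_of_tendsto h1 h2 ?_
  filter_upwards [hc.eventually_le_const one_pos, eventually_gt_atTop 0] with n hn hn0
  have hn0' : (0 : ℝ) < n := by exact_mod_cast hn0
  have hpow : (0 : ℝ) < (2 : ℝ) ^ ((n : ℝ) * R) := by positivity
  have hb := log_le_of_rateExpr_le hpQ hp hC (Nat.ceil_pos.2 hpow) (c n)
  have hl : n * R * Real.log 2 ≤ Real.log (⌈(2 : ℝ) ^ ((n : ℝ) * R)⌉₊ : ℝ) := by
    rw [← Real.log_rpow two_pos]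
    exact Real.log_le_log hpow (Nat.le_ceil _)
  have h3 : (1 - errorProb pQ p (c n)) * (n * R * Real.log 2) ≤
      n * (C * Real.log 2) + Real.log 2 :=
    (mul_le_mul_of_nonneg_left hl (sub_nonneg.2 hn)).trans (by linarith)
  have h4 : (1 - errorProb pQ p (c n)) * R * (n * Real.log 2) ≤
      (C + 1 / n) * (n * Real.log 2) := by
    have : (C + 1 / (n : ℝ)) * (n * Real.log 2) = n * (C * Real.log 2) + Real.log 2 := by
      field_simp
    rw [this]
    linarith
  exact le_of_mul_le_mul_right h4 (by positivity)

end

/-! ### Random codebooks and the one-shot code -/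

section

/-- The derandomisation principle. Total weight at most one suffices because `f` is nonnegative;
this tolerates likelihood ratios whose denominator vanishes. -/
theorem exists_sum_mul_le {α : Type*} [Fintype α] [Nonempty α] {m f : α → ℝ} (hm : ∀ a, 0 ≤ m a)
    (hm1 : ∑ a, m a ≤ 1) (hf : ∀ a, 0 ≤ f a) : ∃ a, ∑ b, m b * f b ≤ f a := by
  obtain ⟨a, -, ha⟩ := Finset.exists_max_image Finset.univ f Finset.univ_nonempty
  refine ⟨a, ?_⟩
  calc ∑ b, m b * f b ≤ ∑ b, m b * f a :=
        Finset.sum_le_sum fun b hb => mul_le_mul_of_nonneg_left (ha b hb) (hm b)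
    _ = (∑ b, m b) * f a := by rw [Finset.sum_mul]
    _ ≤ f a := mul_le_of_le_one_left (hf a) hm1

theorem sum_div_sum_le_one {ι : Type*} (s : Finset ι) (f : ι → ℝ) :
    ∑ i ∈ s, f i / ∑ j ∈ s, f j ≤ 1 := by
  rw [← Finset.sum_div]
  exact div_self_le_one _

section codebook

variable {I 𝒰 : Type*} [Fintype I] [DecidableEq I] [Fintype 𝒰] {π : 𝒰 → ℝ}

/-- In an i.i.d. codebook, the codeword at `i` is independent of every function of the others. -/
theorem sum_codebook_mul (hπ1 : ∑ u, π u = 1) (i : I) (f : 𝒰 → ℝ) (g : (I → 𝒰) → ℝ)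
    (hg : ∀ x x' : I → 𝒰, (∀ j, j ≠ i → x j = x' j) → g x = g x') :
    ∑ c : I → 𝒰, (∏ j, π (c j)) * (f (c i) * g c) =
      (∑ u, π u * f u) * ∑ c : I → 𝒰, (∏ j, π (c j)) * g c := by
  classical
  have h : ∀ c : I → 𝒰, (∏ j, π (c j)) * (f (c i) * g c) =
      ∑ u, f u * ((∏ j, π (c j)) * (if c i = u then g c else 0)) := by
    intro c
    rw [Finset.sum_eq_single (c i)]
    · simp; ring
    · intro u _ hu; simp [hu.symm]
    · simp
  simp only [h]
  rw [Finset.sum_comm, Finset.sum_mul]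
  refine Finset.sum_congr rfl fun u _ => ?_
  rw [← Finset.mul_sum, sum_prod_mul_ite (fun _ => π) i hπ1 g hg u]
  ring

theorem sum_codebook_apply (hπ1 : ∑ u, π u = 1) (i : I) (f : 𝒰 → ℝ) :
    ∑ c : I → 𝒰, (∏ j, π (c j)) * f (c i) = ∑ u, π u * f u := by
  have h := sum_codebook_mul hπ1 i f (fun _ => 1) fun _ _ _ => rfl
  simpa [sum_prod_eq_one fun _ : I => hπ1] using h

/-- The summand `j = i` is kept as it is, the others are independent of `c i` and average out.
Counting `T.card` of them instead of those different from `i` only enlarges the bound. -/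
theorem sum_codebook_mul_sum_le (hπ : ∀ u, 0 ≤ π u) (hπ1 : ∑ u, π u = 1) (i : I) (T : Finset I)
    {f A : 𝒰 → ℝ} (hf : ∀ u, 0 ≤ f u) (hA : ∀ u, 0 ≤ A u) :
    ∑ c : I → 𝒰, (∏ j, π (c j)) * (f (c i) * ∑ j ∈ T, A (c j)) ≤
      ∑ u, π u * (f u * (A u + T.card * ∑ v, π v * A v)) := by
  have hA' : 0 ≤ ∑ v, π v * A v := Finset.sum_nonneg fun v _ => mul_nonneg (hπ v) (hA v)
  have hf' : 0 ≤ ∑ v, π v * f v := Finset.sum_nonneg fun v _ => mul_nonneg (hπ v) (hf v)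
  have h1 : ∑ c : I → 𝒰, (∏ j, π (c j)) * (f (c i) * ∑ j ∈ T, A (c j)) ≤
      ∑ c : I → 𝒰, (∏ j, π (c j)) * (f (c i) * (A (c i) + ∑ j ∈ T.erase i, A (c j))) := by
    refine Finset.sum_le_sum fun c _ => mul_le_mul_of_nonneg_left
      (mul_le_mul_of_nonneg_left ?_ (hf _)) (Finset.prod_nonneg fun _ _ => hπ _)
    by_cases hi : i ∈ T
    · rw [Finset.add_sum_erase T (fun j => A (c j)) hi]
    · rw [Finset.erase_eq_of_notMem hi]
      exact le_add_of_nonneg_left (hA _)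
  refine h1.trans ?_
  have h2 : ∀ j ∈ T.erase i, ∑ c : I → 𝒰, (∏ j, π (c j)) * (f (c i) * A (c j)) =
      (∑ u, π u * f u) * ∑ u, π u * A u := by
    intro j hj
    rw [sum_codebook_mul hπ1 i f (fun c => A (c j))
      (fun x x' h => by rw [h j (Finset.ne_of_mem_erase hj)]), sum_codebook_apply hπ1 j A]
  have h3 : ∑ c : I → 𝒰, (∏ j, π (c j)) * (f (c i) * (A (c i) + ∑ j ∈ T.erase i, A (c j))) =
      ∑ u, π u * (f u * A u) +
        (T.erase i).card * ((∑ u, π u * f u) * ∑ u, π u * A u) := by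
    rw [← nsmul_eq_mul, ← Finset.sum_const, ← Finset.sum_congr rfl h2,
      ← sum_codebook_apply hπ1 i fun u => f u * A u, Finset.sum_comm, ← Finset.sum_add_distrib]
    refine Finset.sum_congr rfl fun c _ => ?_
    rw [mul_add, mul_add, ← Finset.mul_sum, ← Finset.mul_sum]
  have h4 : ∑ u, π u * (f u * (A u + T.card * ∑ v, π v * A v)) =
      ∑ u, π u * (f u * A u) + T.card * ((∑ u, π u * f u) * ∑ u, π u * A u) := by
    generalize ∑ v, π v * A v = Ā
    rw [Finset.sum_mul, Finset.mul_sum, ← Finset.sum_add_distrib]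
    exact Finset.sum_congr rfl fun u _ => by ring
  rw [h3, h4]
  refine add_le_add_right (mul_le_mul_of_nonneg_right ?_ (mul_nonneg hf' hA')) _
  exact_mod_cast Finset.card_le_card (Finset.erase_subset i T)

theorem div_mul_le_self_of_nonneg {x y : ℝ} (hx : 0 ≤ x) : x / y * y ≤ x := by
  rcases eq_or_ne y 0 with rfl | h
  · simpa using hx
  · rw [div_mul_cancel₀ _ h]

/-- The left side is the tangent plane at `(1, 1)` of the convex function `1 / (s t)`. -/
theorem three_sub_le_one_div_mul {s t : ℝ} (hs : 0 < s) (ht : 0 < t) :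
    3 - s - t ≤ 1 / (s * t) := by
  rw [le_div_iff₀ (mul_pos hs ht)]
  rcases le_or_gt (3 - s - t) 0 with h | h
  · nlinarith [mul_pos hs ht]
  · nlinarith [mul_nonneg h.le (sq_nonneg (s - t)),
      mul_nonneg (add_pos hs ht).le (sq_nonneg (s + t - 2)), sq_nonneg (s + t - 2)]

/-- Jensen-type lower bound for the likelihood encoder and decoder over an i.i.d. codebook. -/
theorem sum_codebook_ratio_ge (hπ : ∀ u, 0 ≤ π u) (hπ1 : ∑ u, π u = 1) (i : I) {T₁ T₂ : Finset I}
    (hi₁ : i ∈ T₁) (hi₂ : i ∈ T₂) {h A B : 𝒰 → ℝ} (hh : ∀ u, 0 ≤ h u) (hA : ∀ u, 0 ≤ A u)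
    (hB : ∀ u, 0 ≤ B u) :
    ∑ u, π u * (h u * (A u / (A u + T₁.card * ∑ v, π v * A v)) *
        (B u / (B u + T₂.card * ∑ v, π v * B v))) ≤
      ∑ c : I → 𝒰, (∏ j, π (c j)) * (h (c i) * (A (c i) / ∑ j ∈ T₁, A (c j)) *
        (B (c i) / ∑ j ∈ T₂, B (c j))) := by
  have hA' : 0 ≤ ∑ v, π v * A v := Finset.sum_nonneg fun v _ => mul_nonneg (hπ v) (hA v)
  have hB' : 0 ≤ ∑ v, π v * B v := Finset.sum_nonneg fun v _ => mul_nonneg (hπ v) (hB v)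
  set a : 𝒰 → ℝ := fun u => A u + T₁.card * ∑ v, π v * A v with ha
  set b : 𝒰 → ℝ := fun u => B u + T₂.card * ∑ v, π v * B v with hb
  have ha0 : ∀ u, 0 ≤ a u := fun u => add_nonneg (hA u) (by positivity)
  have hb0 : ∀ u, 0 ≤ b u := fun u => add_nonneg (hB u) (by positivity)
  set k : 𝒰 → ℝ := fun u => h u * (A u / a u) * (B u / b u) with hk
  have hk0 : ∀ u, 0 ≤ k u := fun u => mul_nonneg (mul_nonneg (hh u) (div_nonneg (hA u) (ha0 u)))
    (div_nonneg (hB u) (hb0 u))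
  -- The tangent plane is taken at the points where the random denominators equal `a` and `b`, which
  -- bound their means given `c i`. On averaging, each subtracted term costs at most one copy of
  -- `k`, so one of the three survives.
  have hpt : ∀ c : I → 𝒰, 3 * k (c i) - k (c i) / a (c i) * ∑ j ∈ T₁, A (c j) -
      k (c i) / b (c i) * ∑ j ∈ T₂, B (c j) ≤ h (c i) * (A (c i) / ∑ j ∈ T₁, A (c j)) *
        (B (c i) / ∑ j ∈ T₂, B (c j)) := by
    intro c
    rcases (hA (c i)).eq_or_lt with h1 | h1
    · simp [hk, ← h1]
    rcases (hB (c i)).eq_or_lt with h2 | h2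
    · simp [hk, ← h2]
    have sA : 0 < ∑ j ∈ T₁, A (c j) := h1.trans_le
      (Finset.single_le_sum (f := fun j => A (c j)) (fun _ _ => hA _) hi₁)
    have sB : 0 < ∑ j ∈ T₂, B (c j) := h2.trans_le
      (Finset.single_le_sum (f := fun j => B (c j)) (fun _ _ => hB _) hi₂)
    have pa : 0 < a (c i) := add_pos_of_pos_of_nonneg h1 (by positivity)
    have pb : 0 < b (c i) := add_pos_of_pos_of_nonneg h2 (by positivity)
    have := mul_le_mul_of_nonneg_left
      (three_sub_le_one_div_mul (div_pos sA pa) (div_pos sB pb)) (hk0 (c i))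
    refine le_trans (le_of_eq ?_) (this.trans (le_of_eq ?_))
    · ring
    · simp only [hk]
      field_simp
  have hsum := Finset.sum_le_sum fun c (_ : c ∈ Finset.univ) =>
    mul_le_mul_of_nonneg_left (hpt c) (Finset.prod_nonneg fun j (_ : j ∈ Finset.univ) => hπ (c j))
  refine le_trans ?_ hsum
  simp only [mul_sub, Finset.sum_sub_distrib]
  have e1 := sum_codebook_apply hπ1 i fun u => 3 * k u
  have e2 := sum_codebook_mul_sum_le hπ hπ1 i T₁ (f := fun u => k u / a u)
    (fun u => div_nonneg (hk0 u) (ha0 u)) hA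
  have e3 := sum_codebook_mul_sum_le hπ hπ1 i T₂ (f := fun u => k u / b u)
    (fun u => div_nonneg (hk0 u) (hb0 u)) hB
  have e4 : ∑ u, π u * (k u / a u * (A u + T₁.card * ∑ v, π v * A v)) ≤ ∑ u, π u * k u :=
    Finset.sum_le_sum fun u _ => mul_le_mul_of_nonneg_left
      (div_mul_le_self_of_nonneg (hk0 u)) (hπ u)
  have e5 : ∑ u, π u * (k u / b u * (B u + T₂.card * ∑ v, π v * B v)) ≤ ∑ u, π u * k u :=
    Finset.sum_le_sum fun u _ => mul_le_mul_of_nonneg_left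
      (div_mul_le_self_of_nonneg (hk0 u)) (hπ u)
  have e6 : ∑ u, π u * (3 * k u) = 3 * ∑ u, π u * k u := by
    rw [Finset.mul_sum]
    exact Finset.sum_congr rfl fun u _ => by ring
  rw [e1, e6]
  linarith

end codebook

/-- One-shot achievability for a channel with noncausal side information: for `W` messages and bins
of size `Λ` there are deterministic encoders and decoders doing at least as well as the random
likelihood encoder and decoder with metrics `A` and `B`. -/
theorem exists_oneShot_code {W Λ 𝒰 𝒜 𝒮 𝒳 : Type*} [Fintype W] [Fintype Λ] [Fintype 𝒰] [Fintype 𝒜]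
    [Fintype 𝒮] [Fintype 𝒳] [Nonempty W] [Nonempty Λ] [Nonempty 𝒮] [DecidableEq W]
    {π : 𝒰 → ℝ} (hπ : ∀ u, 0 ≤ π u) (hπ1 : ∑ u, π u = 1)
    {A : 𝒜 → 𝒰 → ℝ} (hA : ∀ a u, 0 ≤ A a u) {B : 𝒳 → 𝒰 → ℝ} (hB : ∀ x u, 0 ≤ B x u)
    {K : 𝒰 → 𝒜 → 𝒮 → ℝ} (hK : ∀ u a s, 0 ≤ K u a s) (hK1 : ∀ u a, ∑ s, K u a s ≤ 1)
    {p : 𝒮 → 𝒜 → 𝒳 → ℝ} (hp : ∀ s a x, 0 ≤ p s a x) :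
    ∃ (enc : W → 𝒜 → 𝒮) (dec : 𝒳 → W),
      ∑ u, ∑ a, ∑ x, ∑ s, π u * A a u * K u a s * p s a x *
        (Fintype.card Λ * (∑ v, π v * A a v) / (A a u + Fintype.card Λ * ∑ v, π v * A a v)) *
        (B x u / (B x u + Fintype.card (W × Λ) * ∑ v, π v * B x v)) ≤
      (1 / (Fintype.card W : ℝ)) * ∑ w, ∑ a, (∑ v, π v * A a v) * ∑ x, p (enc w a) a x *
        (if dec x = w then 1 else 0) := by
  classical
  have hW : (0 : ℝ) < Fintype.card W := by exact_mod_cast Fintype.card_pos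
  have hAb : ∀ a, 0 ≤ ∑ v, π v * A a v := fun a =>
    Finset.sum_nonneg fun v _ => mul_nonneg (hπ v) (hA a v)
  have hne𝒰 : Nonempty 𝒰 := by
    by_contra h
    rw [not_nonempty_iff] at h
    simp at hπ1
  set Ab : 𝒜 → ℝ := fun a => ∑ v, π v * A a v with hAbdef
  set ratio : (W × Λ → 𝒰) → W → Λ → 𝒜 → 𝒳 → ℝ := fun c w l a x =>
    (Ab a * ∑ s, K (c (w, l)) a s * p s a x) * (A a (c (w, l)) / ∑ l', A a (c (w, l'))) *
      (B x (c (w, l)) / ∑ j, B x (c j)) with hratio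
  have hratio0 : ∀ c w l a x, 0 ≤ ratio c w l a x := fun c w l a x =>
    mul_nonneg (mul_nonneg (mul_nonneg (hAb a) (Finset.sum_nonneg fun s _ =>
      mul_nonneg (hK _ _ _) (hp _ _ _))) (div_nonneg (hA _ _) (Finset.sum_nonneg fun _ _ => hA _ _)))
      (div_nonneg (hB _ _) (Finset.sum_nonneg fun _ _ => hB _ _))
  -- Some codebook is at least as good as the average one.
  obtain ⟨c, hc⟩ := exists_sum_mul_le (m := fun c : W × Λ → 𝒰 => ∏ j, π (c j))
    (f := fun c => ∑ w, ∑ l, ∑ a, ∑ x, ratio c w l a x)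
    (fun c => Finset.prod_nonneg fun _ _ => hπ _) (sum_prod_eq_one fun _ => hπ1).le
    (fun c => Finset.sum_nonneg fun w _ => Finset.sum_nonneg fun l _ => Finset.sum_nonneg fun a _ =>
      Finset.sum_nonneg fun x _ => hratio0 c w l a x)
  have havg : Fintype.card W * (∑ u, ∑ a, ∑ x, ∑ s, π u * A a u * K u a s * p s a x *
        (Fintype.card Λ * Ab a / (A a u + Fintype.card Λ * Ab a)) *
        (B x u / (B x u + Fintype.card (W × Λ) * ∑ v, π v * B x v))) ≤
      ∑ w, ∑ l, ∑ a, ∑ x, ratio c w l a x := by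
    refine le_trans ?_ hc
    have hterm : ∀ w l a x, ∑ u, π u * ((Ab a * ∑ s, K u a s * p s a x) *
        (A a u / (A a u + Fintype.card Λ * Ab a)) *
        (B x u / (B x u + Fintype.card (W × Λ) * ∑ v, π v * B x v))) ≤
        ∑ c : W × Λ → 𝒰, (∏ j, π (c j)) * ratio c w l a x := by
      intro w l a x
      -- The encoder competes only within the bin of `w`, the decoder within the whole codebook.
      have h := sum_codebook_ratio_ge hπ hπ1 (w, l)
        (T₁ := Finset.univ.map ⟨fun l' : Λ => (w, l'), fun _ _ h => (Prod.mk.inj h).2⟩)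
        (T₂ := Finset.univ) (Finset.mem_map.2 ⟨l, Finset.mem_univ _, rfl⟩) (Finset.mem_univ _) (h := fun u => Ab a * ∑ s, K u a s * p s a x)
        (A := A a) (B := B x)
        (fun u => mul_nonneg (hAb a) (Finset.sum_nonneg fun s _ => mul_nonneg (hK _ _ _) (hp _ _ _)))
        (hA a) (hB x)
      simp only [Finset.card_map, Finset.card_univ, Finset.sum_map] at h
      exact h
    have hsum := Finset.sum_le_sum fun w (_ : w ∈ (Finset.univ : Finset W)) =>
      Finset.sum_le_sum fun l (_ : l ∈ (Finset.univ : Finset Λ)) =>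
      Finset.sum_le_sum fun a (_ : a ∈ (Finset.univ : Finset 𝒜)) =>
      Finset.sum_le_sum fun x (_ : x ∈ (Finset.univ : Finset 𝒳)) => hterm w l a x
    refine le_trans (le_of_eq ?_) (hsum.trans (le_of_eq ?_))
    · simp only [Finset.sum_const, Finset.card_univ, nsmul_eq_mul]
      congr 1
      simp only [Finset.mul_sum, Finset.sum_mul]
      rw [Finset.sum_comm]
      refine Finset.sum_congr rfl fun a _ => ?_
      rw [Finset.sum_comm]
      refine Finset.sum_congr rfl fun x _ => Finset.sum_congr rfl fun u _ =>
        Finset.sum_congr rfl fun s _ => ?_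
      ring
    · simp only [Finset.mul_sum]
      symm
      rw [Finset.sum_comm]
      refine Finset.sum_congr rfl fun w _ => ?_
      rw [Finset.sum_comm]
      refine Finset.sum_congr rfl fun l _ => ?_
      rw [Finset.sum_comm]
      refine Finset.sum_congr rfl fun a _ => ?_
      rw [Finset.sum_comm]
  set d : 𝒳 → W → ℝ := fun x w => ∑ l, B x (c (w, l)) / ∑ j, B x (c j) with hd
  have hd0 : ∀ x w, 0 ≤ d x w := fun x w =>
    Finset.sum_nonneg fun l _ => div_nonneg (hB _ _) (Finset.sum_nonneg fun _ _ => hB _ _)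
  have hd1 : ∀ x, ∑ w, d x w ≤ 1 := fun x => by
    simp only [hd, ← Fintype.sum_prod_type fun j : W × Λ => B x (c j) / ∑ j, B x (c j)]
    exact sum_div_sum_le_one _ _
  set e : W → 𝒜 → 𝒮 → ℝ := fun w a s => ∑ l, A a (c (w, l)) / (∑ l', A a (c (w, l'))) *
    K (c (w, l)) a s with he
  have he0 : ∀ w a s, 0 ≤ e w a s := fun w a s => Finset.sum_nonneg fun l _ => mul_nonneg
    (div_nonneg (hA _ _) (Finset.sum_nonneg fun _ _ => hA _ _)) (hK _ _ _)
  have he1 : ∀ w a, ∑ s, e w a s ≤ 1 := fun w a => by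
    simp only [he]
    rw [Finset.sum_comm]
    refine (Finset.sum_le_sum fun l _ => ?_).trans
      (sum_div_sum_le_one Finset.univ fun l => A a (c (w, l)))
    rw [← Finset.mul_sum]
    exact mul_le_of_le_one_right
      (div_nonneg (hA _ _) (Finset.sum_nonneg fun _ _ => hA _ _)) (hK1 _ _)
  -- The success probability is linear in the encoder at each `(w, a)` and in the decoder at each
  -- `x`. The encoder is fixed first, against the still randomised decoder.
  have hchoice : ∀ w a, ∃ s, ∑ s', e w a s' * ∑ x, p s' a x * d x w ≤ ∑ x, p s a x * d x w :=
    fun w a => exists_sum_mul_le (he0 w a) (he1 w a) fun s =>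
      Finset.sum_nonneg fun x _ => mul_nonneg (hp _ _ _) (hd0 _ _)
  choose enc henc using hchoice
  have hchoice' : ∀ x, ∃ w, ∑ w', d x w' * ∑ a, Ab a * p (enc w' a) a x ≤
      ∑ a, Ab a * p (enc w a) a x := fun x => exists_sum_mul_le (hd0 x) (hd1 x) fun w =>
      Finset.sum_nonneg fun a _ => mul_nonneg (hAb a) (hp _ _ _)
  choose dec hdec using hchoice'
  refine ⟨enc, dec, ?_⟩
  have h1 : ∑ w, ∑ l, ∑ a, ∑ x, ratio c w l a x ≤
      ∑ w, ∑ a, Ab a * ∑ s, e w a s * ∑ x, p s a x * d x w := by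
    refine Finset.sum_le_sum fun w _ => ?_
    rw [Finset.sum_comm]
    refine Finset.sum_le_sum fun a _ => ?_
    simp only [he, Finset.sum_mul]
    rw [Finset.sum_comm (s := (Finset.univ : Finset 𝒮)), Finset.mul_sum]
    refine Finset.sum_le_sum fun l _ => ?_
    have : ∀ x, ratio c w l a x ≤ (Ab a * ∑ s, K (c (w, l)) a s * p s a x) *
        (A a (c (w, l)) / ∑ l', A a (c (w, l'))) * d x w := by
      intro x
      refine mul_le_mul_of_nonneg_left ?_ ?_
      · exact Finset.single_le_sum (f := fun l => B x (c (w, l)) / ∑ j, B x (c j))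
          (fun l _ => div_nonneg (hB _ _) (Finset.sum_nonneg fun _ _ => hB _ _)) (Finset.mem_univ l)
      · exact mul_nonneg (mul_nonneg (hAb a) (Finset.sum_nonneg fun s _ =>
          mul_nonneg (hK _ _ _) (hp _ _ _)))
          (div_nonneg (hA _ _) (Finset.sum_nonneg fun _ _ => hA _ _))
    refine (Finset.sum_le_sum fun x _ => this x).trans (le_of_eq ?_)
    simp only [Finset.mul_sum, Finset.sum_mul]
    rw [Finset.sum_comm]
    refine Finset.sum_congr rfl fun s _ => Finset.sum_congr rfl fun x _ => ?_
    ring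
  have h2 : ∑ w, ∑ a, Ab a * ∑ s, e w a s * ∑ x, p s a x * d x w ≤
      ∑ w, ∑ a, Ab a * ∑ x, p (enc w a) a x * d x w :=
    Finset.sum_le_sum fun w _ => Finset.sum_le_sum fun a _ =>
      mul_le_mul_of_nonneg_left (henc w a) (hAb a)
  have h3 : ∀ f : 𝒳 → W → ℝ, ∑ w, ∑ a, Ab a * ∑ x, p (enc w a) a x * f x w =
      ∑ x, ∑ w, f x w * ∑ a, Ab a * p (enc w a) a x := by
    intro f
    rw [Finset.sum_comm (s := (Finset.univ : Finset 𝒳))]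
    refine Finset.sum_congr rfl fun w _ => ?_
    simp only [Finset.mul_sum]
    rw [Finset.sum_comm]
    refine Finset.sum_congr rfl fun x _ => Finset.sum_congr rfl fun a _ => ?_
    ring
  rw [h3 d] at h2
  have h4 : ∑ x, ∑ w, d x w * ∑ a, Ab a * p (enc w a) a x ≤
      ∑ x, ∑ w, (if dec x = w then (1 : ℝ) else 0) * ∑ a, Ab a * p (enc w a) a x := by
    refine Finset.sum_le_sum fun x _ => (hdec x).trans (le_of_eq ?_)
    simp
  rw [← h3 fun x w => if dec x = w then (1 : ℝ) else 0] at h4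
  rw [one_div, ← div_eq_inv_mul, le_div_iff₀ hW, mul_comm]
  exact havg.trans (h1.trans (h2.trans h4))

end

/-! ### Exponential-moment bounds and their factorisation -/

section

/-- Indeed `y / (1 + y) ≤ min 1 y ≤ y ^ t`. -/
theorem one_sub_rpow_le_one_div {y t : ℝ} (hy : 0 ≤ y) (ht : 0 < t) (ht1 : t ≤ 1) :
    1 - y ^ t ≤ 1 / (1 + y) := by
  rw [le_div_iff₀ (by linarith)]
  have h0 : 0 ≤ y ^ t := Real.rpow_nonneg hy t
  rcases le_total y 1 with h | h
  · have : y ≤ y ^ t := by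
      rcases hy.eq_or_lt with rfl | hy'
      · exact h0
      · simpa using Real.rpow_le_rpow_of_exponent_ge hy' h ht1
    nlinarith [mul_nonneg hy h0]
  · have : 1 ≤ y ^ t := Real.one_le_rpow h ht.le
    nlinarith [mul_le_mul_of_nonneg_left this hy]

theorem one_sub_rpow_sub_rpow_le {y y' t t' : ℝ} (hy : 0 ≤ y) (hy' : 0 ≤ y') (ht : 0 < t)
    (ht1 : t ≤ 1) (ht' : 0 < t') (ht1' : t' ≤ 1) :
    1 - y ^ t - y' ^ t' ≤ 1 / (1 + y) * (1 / (1 + y')) := by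
  have h1 := one_sub_rpow_le_one_div hy ht ht1
  have h2 := one_sub_rpow_le_one_div hy' ht' ht1'
  have h3 : 1 / (1 + y) ≤ 1 := by rw [div_le_one (by linarith)]; linarith
  have h4 : 1 / (1 + y') ≤ 1 := by rw [div_le_one (by linarith)]; linarith
  nlinarith [mul_nonneg (sub_nonneg.2 h3) (sub_nonneg.2 h4)]

/-- The two ratios are `1 / (1 + y)` with `y = ∏ A / (L ∏ A')` and with `y = N ∏ B' / ∏ B`.
Replacing them by powers gives products over the letters, whose sums over blocks factorise. -/
theorem prod_sub_moments_le {n : ℕ} {j A A' B B' : Fin n → ℝ} (hj : ∀ i, 0 ≤ j i)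
    (hpos : ∀ i, j i ≠ 0 → 0 < A i ∧ 0 < A' i ∧ 0 < B i ∧ 0 < B' i)
    {t t' : ℝ} (ht : 0 < t) (ht1 : t ≤ 1) (ht' : 0 < t') (ht1' : t' ≤ 1)
    {L N : ℝ} (hL : 0 < L) (hN : 0 < N) :
    ∏ i, j i - (1 / L) ^ t * (∏ i, j i * (A i / A' i) ^ t) - N ^ t' * (∏ i, j i *
        (B' i / B i) ^ t') ≤
      (∏ i, j i) * (L * (∏ i, A' i) / (∏ i, A i + L * ∏ i, A' i)) *
        ((∏ i, B i) / (∏ i, B i + N * ∏ i, B' i)) := by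
  rw [Finset.prod_mul_distrib, Finset.prod_mul_distrib]
  rcases (Finset.prod_nonneg fun i (_ : i ∈ Finset.univ) => hj i).eq_or_lt with h0 | h0
  · simp [← h0]
  have hp : ∀ i, 0 < A i ∧ 0 < A' i ∧ 0 < B i ∧ 0 < B' i := fun i =>
    hpos i (Finset.prod_ne_zero_iff.1 h0.ne' i (Finset.mem_univ i))
  have pA : 0 < ∏ i, A i := Finset.prod_pos fun i _ => (hp i).1
  have pA' : 0 < ∏ i, A' i := Finset.prod_pos fun i _ => (hp i).2.1
  have pB : 0 < ∏ i, B i := Finset.prod_pos fun i _ => (hp i).2.2.1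
  have pB' : 0 < ∏ i, B' i := Finset.prod_pos fun i _ => (hp i).2.2.2
  have hkey := one_sub_rpow_sub_rpow_le (y := 1 / L * ((∏ i, A i) / ∏ i, A' i))
    (y' := N * ((∏ i, B' i) / ∏ i, B i)) (by positivity) (by positivity) ht ht1 ht' ht1'
  refine le_trans (le_of_eq ?_) ((mul_le_mul_of_nonneg_left hkey h0.le).trans (le_of_eq ?_))
  · rw [Real.mul_rpow (by positivity) (by positivity), Real.mul_rpow hN.le (by positivity),
      Real.finsetProd_rpow _ _ (fun i _ => (div_pos (hp i).1 (hp i).2.1).le),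
      Real.finsetProd_rpow _ _ (fun i _ => (div_pos (hp i).2.2.2 (hp i).2.2.1).le),
      Finset.prod_div_distrib, Finset.prod_div_distrib]
    ring
  · generalize ∏ i, j i = z at *
    generalize ∏ i, A i = a at *
    generalize ∏ i, A' i = a' at *
    generalize ∏ i, B i = b at *
    generalize ∏ i, B' i = b' at *
    field_simp
    ring

theorem sum_prod_five {α β γ δ ε : Type*} [Fintype α] [Fintype β] [Fintype γ] [Fintype δ]
    [Fintype ε] (n : ℕ) (F : α → β → γ → δ → ε → ℝ) :
    ∑ a : Fin n → α, ∑ b : Fin n → β, ∑ c : Fin n → γ, ∑ d : Fin n → δ, ∑ e : Fin n → ε,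
      ∏ i, F (a i) (b i) (c i) (d i) (e i) = (∑ a, ∑ b, ∑ c, ∑ d, ∑ e, F a b c d e) ^ n := by
  have h1 : ∀ (a : Fin n → α) (b : Fin n → β) (c : Fin n → γ) (d : Fin n → δ),
      ∑ e : Fin n → ε, ∏ i, F (a i) (b i) (c i) (d i) (e i) =
        ∏ i, ∑ e, F (a i) (b i) (c i) (d i) e := fun a b c d =>
    (Fintype.prod_sum fun i e => F (a i) (b i) (c i) (d i) e).symm
  have h2 : ∀ (a : Fin n → α) (b : Fin n → β) (c : Fin n → γ),
      ∑ d : Fin n → δ, ∏ i, ∑ e, F (a i) (b i) (c i) (d i) e =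
        ∏ i, ∑ d, ∑ e, F (a i) (b i) (c i) d e := fun a b c =>
    (Fintype.prod_sum fun i d => ∑ e, F (a i) (b i) (c i) d e).symm
  have h3 : ∀ (a : Fin n → α) (b : Fin n → β),
      ∑ c : Fin n → γ, ∏ i, ∑ d, ∑ e, F (a i) (b i) (c i) d e =
        ∏ i, ∑ c, ∑ d, ∑ e, F (a i) (b i) c d e := fun a b =>
    (Fintype.prod_sum fun i c => ∑ d, ∑ e, F (a i) (b i) c d e).symm
  have h4 : ∀ a : Fin n → α,
      ∑ b : Fin n → β, ∏ i, ∑ c, ∑ d, ∑ e, F (a i) (b i) c d e =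
        ∏ i, ∑ b, ∑ c, ∑ d, ∑ e, F (a i) b c d e := fun a =>
    (Fintype.prod_sum fun i b => ∑ c, ∑ d, ∑ e, F (a i) b c d e).symm
  have h5 : ∑ a : Fin n → α, ∏ i, ∑ b, ∑ c, ∑ d, ∑ e, F (a i) b c d e =
      ∏ _i : Fin n, ∑ a, ∑ b, ∑ c, ∑ d, ∑ e, F a b c d e :=
    (Fintype.prod_sum fun _ a => ∑ b, ∑ c, ∑ d, ∑ e, F a b c d e).symm
  simp only [h1, h2, h3, h4, h5, Finset.prod_const, Finset.card_univ, Fintype.card_fin]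

end

/-! ### Block codes and Chernoff's bound -/

section

variable {Q₀ Q₁ S X 𝒰 : Type*} [Fintype Q₀] [Fintype Q₁] [Fintype S] [Fintype X] [Fintype 𝒰]

/-- Block codes obtained by applying the one-shot construction conditionally on every context
sequence known to the receiver, from single-letter kernels `π` (codebook), `A` (encoder metric), `B`
(decoder metric) and `K` (channel input). -/
theorem exists_code_success_ge [Nonempty S] {pQ : Q₀ × Q₁ → ℝ}
    (hpQ : pQ ∈ stdSimplex ℝ (Q₀ × Q₁)) {p : S → Q₀ × Q₁ → X → ℝ}
    (hp : ∀ s q, p s q ∈ stdSimplex ℝ X)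
    {P₀ : Q₀ → ℝ} (hP₀ : ∀ q, 0 ≤ P₀ q) {π : Q₀ → 𝒰 → ℝ} (hπ : ∀ q u, 0 ≤ π q u)
    (hπ1 : ∀ q, P₀ q ≠ 0 → ∑ u, π q u = 1) {A : Q₀ → Q₁ → 𝒰 → ℝ} (hA : ∀ q a u, 0 ≤ A q a u)
    {B : Q₀ → X → 𝒰 → ℝ} (hB : ∀ q x u, 0 ≤ B q x u) {K : 𝒰 → Q₀ × Q₁ → S → ℝ}
    (hK : ∀ u q s, 0 ≤ K u q s) (hK1 : ∀ u q, ∑ s, K u q s ≤ 1)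
    (hAQ : ∀ q a, P₀ q * ∑ u, π q u * A q a u = pQ (q, a))
    (n : ℕ) {M L : ℕ} (hM : 0 < M) (hL : 0 < L) :
    ∃ c : Code Q₀ Q₁ S X n M, ∑ q : Fin n → Q₀, (∏ i, P₀ (q i)) *
      (∑ u : Fin n → 𝒰, ∑ a : Fin n → Q₁, ∑ x : Fin n → X, ∑ s : Fin n → S,
        (∏ i, π (q i) (u i)) * (∏ i, A (q i) (a i) (u i)) * (∏ i, K (u i) (q i, a i) (s i)) *
        (∏ i, p (s i) (q i, a i) (x i)) *
        (L * (∏ i, ∑ v, π (q i) v * A (q i) (a i) v) /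
          (∏ i, A (q i) (a i) (u i) + L * ∏ i, ∑ v, π (q i) v * A (q i) (a i) v)) *
        ((∏ i, B (q i) (x i) (u i)) /
          (∏ i, B (q i) (x i) (u i) + M * L * ∏ i, ∑ v, π (q i) v * B (q i) (x i) v))) ≤
      1 - errorProb pQ p c := by
  classical
  have : Nonempty (Fin M) := ⟨⟨0, hM⟩⟩
  have : Nonempty (Fin L) := ⟨⟨0, hL⟩⟩
  set Ab : Q₀ → Q₁ → ℝ := fun q a => ∑ v, π q v * A q a v with hAb
  set Bb : Q₀ → X → ℝ := fun q x => ∑ v, π q v * B q x v with hBb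
  have hAbn : ∀ (q : Fin n → Q₀) (a : Fin n → Q₁),
      ∑ v : Fin n → 𝒰, (∏ i, π (q i) (v i)) * ∏ i, A (q i) (a i) (v i) = ∏ i, Ab (q i) (a i) := by
    intro q a
    simp only [hAb, ← Finset.prod_mul_distrib]
    exact (Fintype.prod_sum fun i v => π (q i) v * A (q i) (a i) v).symm
  have hBbn : ∀ (q : Fin n → Q₀) (x : Fin n → X),
      ∑ v : Fin n → 𝒰, (∏ i, π (q i) (v i)) * ∏ i, B (q i) (x i) (v i) = ∏ i, Bb (q i) (x i) := by
    intro q x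
    simp only [hBb, ← Finset.prod_mul_distrib]
    exact (Fintype.prod_sum fun i v => π (q i) v * B (q i) (x i) v).symm
  have hpq0 : ∀ q : Fin n → Q₀, ∃ (enc : Fin M → (Fin n → Q₁) → (Fin n → S))
      (dec : (Fin n → X) → Fin M), (∏ i, P₀ (q i)) *
      (∑ u : Fin n → 𝒰, ∑ a : Fin n → Q₁, ∑ x : Fin n → X, ∑ s : Fin n → S,
        (∏ i, π (q i) (u i)) * (∏ i, A (q i) (a i) (u i)) * (∏ i, K (u i) (q i, a i) (s i)) *
        (∏ i, p (s i) (q i, a i) (x i)) *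
        (L * (∏ i, Ab (q i) (a i)) / (∏ i, A (q i) (a i) (u i) + L * ∏ i, Ab (q i) (a i))) *
        ((∏ i, B (q i) (x i) (u i)) / (∏ i, B (q i) (x i) (u i) + M * L * ∏ i, Bb (q i) (x i)))) ≤
      (∏ i, P₀ (q i)) * ((1 / (M : ℝ)) * ∑ w, ∑ a : Fin n → Q₁, (∏ i, Ab (q i) (a i)) *
        ∑ x : Fin n → X, (∏ i, p (enc w a i) (q i, a i) (x i)) *
          (if dec x = w then 1 else 0)) := by
    intro q
    -- `π` is only assumed normalised where `P₀` is nonzero; elsewhere both sides vanish.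
    by_cases h0 : ∏ i, P₀ (q i) = 0
    · simp only [h0, zero_mul, le_refl, exists_const]
    obtain ⟨enc, dec, h⟩ := exists_oneShot_code (W := Fin M) (Λ := Fin L)
      (π := fun u : Fin n → 𝒰 => ∏ i, π (q i) (u i))
      (fun u => Finset.prod_nonneg fun i _ => hπ _ _)
      (sum_prod_eq_one fun i => hπ1 _ (Finset.prod_ne_zero_iff.1 h0 i (Finset.mem_univ i)))
      (A := fun (a : Fin n → Q₁) u => ∏ i, A (q i) (a i) (u i))
      (fun a u => Finset.prod_nonneg fun i _ => hA _ _ _)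
      (B := fun (x : Fin n → X) u => ∏ i, B (q i) (x i) (u i))
      (fun a u => Finset.prod_nonneg fun i _ => hB _ _ _)
      (K := fun u a (s : Fin n → S) => ∏ i, K (u i) (q i, a i) (s i))
      (fun u a s => Finset.prod_nonneg fun i _ => hK _ _ _)
      (fun u a => by
        rw [← Fintype.prod_sum fun i s => K (u i) (q i, a i) s]
        exact Finset.prod_le_one (fun i _ => Finset.sum_nonneg fun s _ => hK _ _ _)
          fun i _ => hK1 _ _)
      (p := fun s a (x : Fin n → X) => ∏ i, p (s i) (q i, a i) (x i))
      (fun s a x => Finset.prod_nonneg fun i _ => (hp _ _).1 _)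
    refine ⟨enc, dec, mul_le_mul_of_nonneg_left ?_ (Finset.prod_nonneg fun i _ => hP₀ _)⟩
    simp only [hAbn, hBbn, Fintype.card_prod, Fintype.card_fin, Nat.cast_mul] at h
    exact h
  choose enc dec hcode using hpq0
  refine ⟨⟨fun w q => enc (fun i => (q i).1) w fun i => (q i).2, fun x q => dec q x⟩, ?_⟩
  set c : Code Q₀ Q₁ S X n M :=
    ⟨fun w q => enc (fun i => (q i).1) w fun i => (q i).2, fun x q => dec q x⟩ with hc
  have hsucc : 1 - errorProb pQ p c = ∑ q : Fin n → Q₀, (∏ i, P₀ (q i)) * ((1 / (M : ℝ)) *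
      ∑ w, ∑ a : Fin n → Q₁, (∏ i, Ab (q i) (a i)) *
        ∑ x : Fin n → X, (∏ i, p (enc q w a i) (q i, a i) (x i)) *
          (if dec q x = w then 1 else 0)) := by
    have h1 := sum_codeLaw hpQ hp hM c
    have h2 : 1 - errorProb pQ p c = ∑ ω, codeLaw pQ p c ω *
        (if c.dec ω.2.2 (fun i => (ω.2.1 i).1) = ω.1 then 1 else 0) := by
      have h0 : 1 - errorProb pQ p c = ∑ ω, codeLaw pQ p c ω - errorProb pQ p c := by rw [h1]
      rw [h0, errorProb_eq_sum_codeLaw, ← Finset.sum_sub_distrib]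
      refine Finset.sum_congr rfl fun ω _ => ?_
      split_ifs <;> simp
    rw [h2]
    simp only [Fintype.sum_prod_type, codeLaw, Finset.mul_sum]
    rw [Finset.sum_comm (s := (Finset.univ : Finset (Fin n → Q₀)))]
    refine Finset.sum_congr rfl fun w _ => ?_
    rw [← Equiv.sum_comp (Equiv.arrowProdEquivProdArrow (Fin n) (fun _ => Q₀) (fun _ => Q₁)).symm,
      Fintype.sum_prod_type]
    refine Finset.sum_congr rfl fun q _ => Finset.sum_congr rfl fun a _ =>
      Finset.sum_congr rfl fun x _ => ?_
    have h3 : ∏ i, pQ (q i, a i) = (∏ i, P₀ (q i)) * ∏ i, Ab (q i) (a i) := by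
      rw [← Finset.prod_mul_distrib]
      exact Finset.prod_congr rfl fun i _ => (hAQ _ _).symm
    change 1 / (M : ℝ) * ((∏ i, pQ (q i, a i)) * ∏ i, p (enc q w a i) (q i, a i) (x i)) *
      (if dec q x = w then 1 else 0) = _
    rw [h3]
    ring
  rw [hsucc]
  exact Finset.sum_le_sum fun q _ => hcode q

/-- Block codes whose error probability obeys an exponential-moment bound. -/
theorem exists_code_errorProb_le [Nonempty S] {pQ : Q₀ × Q₁ → ℝ}
    (hpQ : pQ ∈ stdSimplex ℝ (Q₀ × Q₁)) {p : S → Q₀ × Q₁ → X → ℝ}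
    (hp : ∀ s q, p s q ∈ stdSimplex ℝ X)
    {P₀ : Q₀ → ℝ} (hP₀ : ∀ q, 0 ≤ P₀ q) {π : Q₀ → 𝒰 → ℝ} (hπ : ∀ q u, 0 ≤ π q u)
    (hπ1 : ∀ q, P₀ q ≠ 0 → ∑ u, π q u = 1) {A : Q₀ → Q₁ → 𝒰 → ℝ} (hA : ∀ q a u, 0 ≤ A q a u)
    {B : Q₀ → X → 𝒰 → ℝ} (hB : ∀ q x u, 0 ≤ B q x u) {K : 𝒰 → Q₀ × Q₁ → S → ℝ}
    (hK : ∀ u q s, 0 ≤ K u q s) (hK1 : ∀ u q, ∑ s, K u q s ≤ 1)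
    (hAQ : ∀ q a, P₀ q * ∑ u, π q u * A q a u = pQ (q, a))
    {J : Q₀ → 𝒰 → Q₁ → X → S → ℝ}
    (hJ : ∀ q u a x s, J q u a x s = P₀ q * π q u * A q a u * K u (q, a) s * p s (q, a) x)
    (hJ1 : ∑ q, ∑ u, ∑ a, ∑ x, ∑ s, J q u a x s = 1)
    (hJB : ∀ q u a x s, J q u a x s ≠ 0 → B q x u ≠ 0)
    {t t' : ℝ} (ht : 0 < t) (ht1 : t ≤ 1) (ht' : 0 < t') (ht1' : t' ≤ 1)
    (n : ℕ) {M L : ℕ} (hM : 0 < M) (hL : 0 < L) :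
    ∃ c : Code Q₀ Q₁ S X n M, errorProb pQ p c ≤
      (1 / (L : ℝ)) ^ t * (∑ q, ∑ u, ∑ a, ∑ x, ∑ s, J q u a x s *
        (A q a u / ∑ v, π q v * A q a v) ^ t) ^ n +
      ((M : ℝ) * L) ^ t' * (∑ q, ∑ u, ∑ a, ∑ x, ∑ s, J q u a x s *
        ((∑ v, π q v * B q x v) / B q x u) ^ t') ^ n := by
  obtain ⟨c, hc⟩ := exists_code_success_ge hpQ hp hP₀ hπ hπ1 hA hB hK hK1 hAQ n hM hL
  refine ⟨c, ?_⟩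
  have hM' : (0 : ℝ) < M := by exact_mod_cast hM
  have hL' : (0 : ℝ) < L := by exact_mod_cast hL
  set Ab : Q₀ → Q₁ → ℝ := fun q a => ∑ v, π q v * A q a v with hAb
  set Bb : Q₀ → X → ℝ := fun q x => ∑ v, π q v * B q x v with hBb
  have hJ0 : ∀ q u a x s, 0 ≤ J q u a x s := fun q u a x s => by
    rw [hJ]
    exact mul_nonneg (mul_nonneg (mul_nonneg (mul_nonneg (hP₀ q) (hπ _ _)) (hA _ _ _)) (hK _ _ _))
      ((hp _ _).1 _)
  have hpos : ∀ q u a x s, J q u a x s ≠ 0 →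
      0 < A q a u ∧ 0 < Ab q a ∧ 0 < B q x u ∧ 0 < Bb q x := by
    intro q u a x s h
    have h2 := (hB _ _ _).lt_of_ne' (hJB _ _ _ _ _ h)
    have h1 : 0 < A q a u ∧ 0 < π q u := by
      rw [hJ] at h
      refine ⟨(hA _ _ _).lt_of_ne' ?_, (hπ _ _).lt_of_ne' ?_⟩ <;>
      · intro h'; exact h (by rw [h']; ring)
    exact ⟨h1.1, (mul_pos h1.2 h1.1).trans_le (Finset.single_le_sum
        (f := fun v => π q v * A q a v)
        (fun v _ => mul_nonneg (hπ _ _) (hA _ _ _)) (Finset.mem_univ u)), h2,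
      (mul_pos h1.2 h2).trans_le (Finset.single_le_sum (f := fun v => π q v * B q x v)
        (fun v _ => mul_nonneg (hπ _ _) (hB _ _ _)) (Finset.mem_univ u))⟩
  have hpt : ∀ (q : Fin n → Q₀) (u : Fin n → 𝒰) (a : Fin n → Q₁) (x : Fin n → X) (s : Fin n → S),
      ∏ i, J (q i) (u i) (a i) (x i) (s i) -
      (1 / (L : ℝ)) ^ t * (∏ i, J (q i) (u i) (a i) (x i) (s i) *
        (A (q i) (a i) (u i) / Ab (q i) (a i)) ^ t) -
      ((M : ℝ) * L) ^ t' * (∏ i, J (q i) (u i) (a i) (x i) (s i) *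
        (Bb (q i) (x i) / B (q i) (x i) (u i)) ^ t') ≤
      (∏ i, P₀ (q i)) * ((∏ i, π (q i) (u i)) * (∏ i, A (q i) (a i) (u i)) *
        (∏ i, K (u i) (q i, a i) (s i)) * (∏ i, p (s i) (q i, a i) (x i)) *
        (L * (∏ i, Ab (q i) (a i)) / (∏ i, A (q i) (a i) (u i) + L * ∏ i, Ab (q i) (a i))) *
        ((∏ i, B (q i) (x i) (u i)) /
          (∏ i, B (q i) (x i) (u i) + M * L * ∏ i, Bb (q i) (x i)))) := by
    intro q u a x s
    refine (prod_sub_moments_le (fun i => hJ0 _ _ _ _ _) (fun i => hpos _ _ _ _ _) ht ht1 ht' ht1'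
      hL' (mul_pos hM' hL')).trans (le_of_eq ?_)
    simp only [hJ, Finset.prod_mul_distrib]
    ring
  have hle := Finset.sum_le_sum fun q (_ : q ∈ (Finset.univ : Finset (Fin n → Q₀))) =>
    Finset.sum_le_sum fun u (_ : u ∈ (Finset.univ : Finset (Fin n → 𝒰))) =>
    Finset.sum_le_sum fun a (_ : a ∈ (Finset.univ : Finset (Fin n → Q₁))) =>
    Finset.sum_le_sum fun x (_ : x ∈ (Finset.univ : Finset (Fin n → X))) =>
    Finset.sum_le_sum fun s (_ : s ∈ (Finset.univ : Finset (Fin n → S))) => hpt q u a x s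
  simp only [Finset.sum_sub_distrib, ← Finset.mul_sum] at hle
  rw [sum_prod_five n fun q u a x s => J q u a x s * (A q a u / Ab q a) ^ t,
    sum_prod_five n fun q u a x s => J q u a x s * (Bb q x / B q x u) ^ t'] at hle
  rw [sum_prod_five n J, hJ1, one_pow] at hle
  simp only [Finset.mul_sum] at hc hle ⊢
  linarith

/-- Chernoff's exponential-moment bound at a small exponent. -/
theorem exists_sum_rpow_le_exp {ι : Type*} [Fintype ι] {m ρ : ι → ℝ} (hm1 : ∑ i, m i = 1)
    (hρ : ∀ i, m i ≠ 0 → 0 < ρ i) {D : ℝ}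
    (hD : ∑ i, m i * Real.log (ρ i) < D) :
    ∃ t, 0 < t ∧ t ≤ 1 ∧ ∑ i, m i * ρ i ^ t ≤ Real.exp (t * D) := by
  -- `f 0 = 1` and `f` has negative derivative at `0`, so `f ≤ 1` at some small positive `t`.
  set f : ℝ → ℝ := fun t => ∑ i, m i * Real.exp (t * (Real.log (ρ i) - D)) with hf
  have hder : HasDerivAt f (∑ i, m i * Real.log (ρ i) - D) 0 := by
    have h1 : HasDerivAt f (∑ i, m i * (Real.exp (0 * (Real.log (ρ i) - D)) *
        (1 * (Real.log (ρ i) - D)))) 0 :=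
      HasDerivAt.fun_sum fun i _ =>
        (((hasDerivAt_id (0 : ℝ)).mul_const (Real.log (ρ i) - D)).exp).const_mul (m i)
    convert h1 using 1
    simp only [zero_mul, Real.exp_zero, one_mul]
    simp only [mul_sub, Finset.sum_sub_distrib, ← Finset.sum_mul, hm1,
      one_mul]
  have hf0 : f 0 = 1 := by simp [hf, hm1]
  have hev := (hasDerivAt_iff_tendsto_slope.1 hder).eventually_lt_const (sub_neg.2 hD)
  have hev' : ∀ᶠ t in 𝓝[>] (0 : ℝ), slope f 0 t < 0 :=
    hev.filter_mono (nhdsWithin_mono 0 fun t (ht : 0 < t) => ht.ne')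
  obtain ⟨t, hts, ht0, ht1⟩ := (hev'.and (Ioc_mem_nhdsGT one_pos)).exists
  refine ⟨t, ht0, ht1, ?_⟩
  rw [slope_def_field, sub_zero, div_neg_iff] at hts
  have hft : f t ≤ 1 := by
    rcases hts with h | h
    · exact absurd h.2 (not_lt.2 ht0.le)
    · linarith [h.1]
  have h2 : ∑ i, m i * ρ i ^ t = f t * Real.exp (t * D) := by
    simp only [hf, Finset.sum_mul]
    refine Finset.sum_congr rfl fun i _ => ?_
    by_cases h : m i = 0
    · simp [h]
    · rw [Real.rpow_def_of_pos (hρ i h), mul_assoc, ← Real.exp_add]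
      congr 2
      ring
  rw [h2]
  exact mul_le_of_le_one_left (Real.exp_pos _).le hft

end

/-- From `log y ≥ 1 - 1/y`: for each `c` the product of the conditional marginals has no more mass
than `P`. -/
theorem condMutualInfo_nonneg {A B C : Type*} [Fintype A] [Fintype B] [Fintype C]
    {P : A → B → C → ℝ} (hP : ∀ a b c, 0 ≤ P a b c) : 0 ≤ condMutualInfo P := by
  have hac : ∀ a c, 0 ≤ ∑ b, P a b c := fun a c => Finset.sum_nonneg fun _ _ => hP _ _ _
  have hbc : ∀ b c, 0 ≤ ∑ a, P a b c := fun b c => Finset.sum_nonneg fun _ _ => hP _ _ _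
  have hc0 : ∀ c, 0 ≤ ∑ a, ∑ b, P a b c := fun c => Finset.sum_nonneg fun _ _ => hac _ _
  have key : ∀ a b c, P a b c - (∑ b', P a b' c) * (∑ a', P a' b c) / ∑ a', ∑ b', P a' b' c ≤
      P a b c * Real.logb 2 ((P a b c * ∑ a', ∑ b', P a' b' c) /
        ((∑ b', P a b' c) * ∑ a', P a' b c)) * Real.log 2 := by
    intro a b c
    rcases (hP a b c).eq_or_lt with h | h
    · rw [← h]
      simp only [zero_mul, zero_sub, neg_nonpos]
      exact div_nonneg (mul_nonneg (hac _ _) (hbc _ _)) (hc0 _)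
    have h1 : 0 < ∑ b', P a b' c :=
      h.trans_le (Finset.single_le_sum (f := fun b' => P a b' c) (fun _ _ => hP _ _ _)
        (Finset.mem_univ b))
    have h3 : 0 < ∑ a', P a' b c :=
      h.trans_le (Finset.single_le_sum (f := fun a' => P a' b c) (fun _ _ => hP _ _ _)
        (Finset.mem_univ a))
    have h4 : 0 < ∑ a', ∑ b', P a' b' c :=
      h1.trans_le (Finset.single_le_sum (f := fun a' => ∑ b', P a' b' c)
        (fun _ _ => hac _ _) (Finset.mem_univ a))
    rw [mul_assoc, Real.logb, div_mul_cancel₀ _ (Real.log_pos one_lt_two).ne']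
    have h5 := Real.one_sub_inv_le_log_of_pos (div_pos (mul_pos h h4) (mul_pos h1 h3))
    refine le_trans (le_of_eq ?_) (mul_le_mul_of_nonneg_left h5 h.le)
    field_simp
  have hsum := Finset.sum_le_sum fun a (_ : a ∈ (Finset.univ : Finset A)) =>
    Finset.sum_le_sum fun b (_ : b ∈ (Finset.univ : Finset B)) =>
    Finset.sum_le_sum fun c (_ : c ∈ (Finset.univ : Finset C)) => key a b c
  simp only [← Finset.sum_mul] at hsum
  have h0 : 0 ≤ ∑ a, ∑ b, ∑ c,
      (P a b c - (∑ b', P a b' c) * (∑ a', P a' b c) / ∑ a', ∑ b', P a' b' c) := by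
    have h1 : ∀ f : A → B → C → ℝ, ∑ a, ∑ b, ∑ c, f a b c = ∑ c, ∑ a, ∑ b, f a b c := by
      intro f
      rw [Finset.sum_comm (s := (Finset.univ : Finset C))]
      exact Finset.sum_congr rfl fun a _ => Finset.sum_comm
    rw [h1]
    refine Finset.sum_nonneg fun c _ => ?_
    simp only [Finset.sum_sub_distrib, ← Finset.sum_div, ← Finset.mul_sum, ← Finset.sum_mul]
    rw [Finset.sum_comm (f := fun b a => P a b c)]
    rw [sub_nonneg]
    exact (mul_self_div_self _).le
  exact nonneg_of_mul_nonneg_left (h0.trans hsum) (Real.log_pos one_lt_two)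

/-! ### Achievability of rates below the single-letter expression -/

section

variable {Q₀ Q₁ S X : Type*} [Fintype Q₀] [Fintype Q₁] [Fintype S] [Fintype X]

/-- Every nonnegative rate below the single-letter rate expression is achievable. -/
theorem achievable_of_lt_rateExpr [Nonempty S] {pQ : Q₀ × Q₁ → ℝ}
    (hpQ : pQ ∈ stdSimplex ℝ (Q₀ × Q₁)) {p : S → Q₀ × Q₁ → X → ℝ}
    (hp : ∀ s q, p s q ∈ stdSimplex ℝ X) {𝒰 : Type*} [Fintype 𝒰] {r : Q₀ × Q₁ → 𝒰 × S → ℝ}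
    (hr : ∀ q, r q ∈ stdSimplex ℝ (𝒰 × S)) {R : ℝ} (hR0 : 0 ≤ R) (hR : R < rateExpr pQ p r) :
    Achievable pQ p R := by
  have hlog : 0 < Real.log 2 := Real.log_pos one_lt_two
  set J : Q₀ → 𝒰 → Q₁ → X → S → ℝ := fun q u a x s => jointLaw pQ p r u s (q, a) x with hJ
  have hJ0 : ∀ q u a x s, 0 ≤ J q u a x s := fun q u a x s =>
    mul_nonneg (mul_nonneg (hpQ.1 _) ((hr _).1 _)) ((hp _ _).1 _)
  set P₀ : Q₀ → ℝ := fun q => ∑ a, pQ (q, a) with hP₀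
  set m : Q₀ → Q₁ → 𝒰 → ℝ := fun q a u => ∑ s, ∑ x, J q u a x s with hm
  set m₀ : Q₀ → 𝒰 → ℝ := fun q u => ∑ a, m q a u with hm₀
  set mx : Q₀ → X → 𝒰 → ℝ := fun q x u => ∑ s, ∑ a, J q u a x s with hmx
  have hm' : ∀ q a u, m q a u = pQ (q, a) * ∑ s, r (q, a) (u, s) := by
    intro q a u
    simp only [hm, hJ, jointLaw, ← Finset.mul_sum, (hp _ _).2, mul_one]
  have m_nonneg : ∀ q a u, 0 ≤ m q a u := fun q a u =>
    Finset.sum_nonneg fun s _ => Finset.sum_nonneg fun x _ => hJ0 _ _ _ _ _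
  have mx_nonneg : ∀ q x u, 0 ≤ mx q x u := fun q a u =>
    Finset.sum_nonneg fun s _ => Finset.sum_nonneg fun x _ => hJ0 _ _ _ _ _
  have m₀_nonneg : ∀ q u, 0 ≤ m₀ q u := fun q u => Finset.sum_nonneg fun a _ => m_nonneg _ _ _
  have P₀_nonneg : ∀ q, 0 ≤ P₀ q := fun q => Finset.sum_nonneg fun a _ => hpQ.1 _
  have sum_m : ∀ q a, ∑ u, m q a u = pQ (q, a) := by
    intro q a
    simp only [hm', ← Finset.mul_sum]
    rw [← Fintype.sum_prod_type, (hr _).2, mul_one]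
  have sum_m₀ : ∀ q, ∑ u, m₀ q u = P₀ q := by
    intro q
    simp only [hm₀, hP₀]
    rw [Finset.sum_comm]
    simp only [sum_m]
  have sum_mx : ∀ q u, ∑ x, mx q x u = m₀ q u := by
    intro q u
    simp only [hmx, hm₀, hm]
    rw [Finset.sum_comm, Finset.sum_comm (s := (Finset.univ : Finset Q₁))]
    exact Finset.sum_congr rfl fun s _ => Finset.sum_comm
  have m₀_zero : ∀ q u, P₀ q = 0 → m₀ q u = 0 := fun q u h =>
    (Finset.sum_eq_zero_iff_of_nonneg fun u _ => m₀_nonneg q u).1 ((sum_m₀ q).trans h) u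
      (Finset.mem_univ u)
  have m_zero : ∀ q a u, m₀ q u = 0 → m q a u = 0 := fun q a u h =>
    (Finset.sum_eq_zero_iff_of_nonneg fun a _ => m_nonneg q a u).1 h a (Finset.mem_univ a)
  have mx_zero : ∀ q x u, m₀ q u = 0 → mx q x u = 0 := fun q x u h =>
    (Finset.sum_eq_zero_iff_of_nonneg fun x _ => mx_nonneg q x u).1 ((sum_mx q u).trans h) x
      (Finset.mem_univ x)
  -- The kernels are `p(u|q₀)`, `p(q̃₁|u,q₀)`, `p(x|u,q₀)` and `p(s|u,q₀,q̃₁)`; on null events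
  -- division by zero makes them zero.
  set π : Q₀ → 𝒰 → ℝ := fun q u => m₀ q u / P₀ q with hπ
  set A : Q₀ → Q₁ → 𝒰 → ℝ := fun q a u => m q a u / m₀ q u with hA
  set B : Q₀ → X → 𝒰 → ℝ := fun q x u => mx q x u / m₀ q u with hB
  set K : 𝒰 → Q₀ × Q₁ → S → ℝ := fun u q s => r q (u, s) / ∑ s', r q (u, s') with hK
  have hAb : ∀ q a, ∑ u, π q u * A q a u = pQ (q, a) / P₀ q := by
    intro q a
    rw [← sum_m, Finset.sum_div]
    refine Finset.sum_congr rfl fun u _ => ?_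
    simp only [hπ, hA]
    rw [div_mul_eq_mul_div, mul_div_cancel_of_imp' (m_zero q a u)]
  have hBb : ∀ q x, ∑ u, π q u * B q x u = (∑ u, mx q x u) / P₀ q := by
    intro q x
    rw [Finset.sum_div]
    refine Finset.sum_congr rfl fun u _ => ?_
    simp only [hπ, hB]
    rw [div_mul_eq_mul_div, mul_div_cancel_of_imp' (mx_zero q x u)]
  have pQ_zero : ∀ q a, P₀ q = 0 → pQ (q, a) = 0 := fun q a h =>
    (Finset.sum_eq_zero_iff_of_nonneg fun a _ => hpQ.1 (q, a)).1 h a (Finset.mem_univ a)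
  have hJfac : ∀ q u a x s,
      J q u a x s = P₀ q * π q u * A q a u * K u (q, a) s * p s (q, a) x := by
    intro q u a x s
    have h1 : P₀ q * π q u = m₀ q u := mul_div_cancel_of_imp' (m₀_zero q u)
    have h2 : m₀ q u * A q a u = m q a u := mul_div_cancel_of_imp' (m_zero q a u)
    have h3 : (∑ s', r (q, a) (u, s')) * K u (q, a) s = r (q, a) (u, s) :=
      mul_div_cancel_of_imp' fun h => (Finset.sum_eq_zero_iff_of_nonneg fun s _ =>
        (hr (q, a)).1 (u, s)).1 h s (Finset.mem_univ s)
    rw [h1, h2, hm', mul_assoc (pQ (q, a)), h3]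
    rfl
  have hJ1 : ∑ q, ∑ u, ∑ a, ∑ x, ∑ s, J q u a x s = 1 := by
    rw [← hpQ.2, Fintype.sum_prod_type]
    refine Finset.sum_congr rfl fun q _ => ?_
    rw [Finset.sum_comm]
    refine Finset.sum_congr rfl fun a _ => ?_
    rw [← sum_m]
    exact Finset.sum_congr rfl fun u _ => Finset.sum_comm
  have J_pos : ∀ q u a x s, J q u a x s ≠ 0 →
      0 < m q a u ∧ 0 < mx q x u ∧ 0 < m₀ q u ∧ 0 < P₀ q ∧ 0 < pQ (q, a) := by
    intro q u a x s h
    have h0 : 0 < J q u a x s := (hJ0 _ _ _ _ _).lt_of_ne' h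
    have h1 : 0 < m q a u := h0.trans_le <|
      (Finset.single_le_sum (f := fun x => J q u a x s) (fun _ _ => hJ0 _ _ _ _ _)
        (Finset.mem_univ x)).trans (Finset.single_le_sum (f := fun s => ∑ x, J q u a x s)
        (fun _ _ => Finset.sum_nonneg fun _ _ => hJ0 _ _ _ _ _) (Finset.mem_univ s))
    have h2 : 0 < mx q x u := h0.trans_le <|
      (Finset.single_le_sum (f := fun a => J q u a x s) (fun _ _ => hJ0 _ _ _ _ _)
        (Finset.mem_univ a)).trans (Finset.single_le_sum (f := fun s => ∑ a, J q u a x s)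
        (fun _ _ => Finset.sum_nonneg fun _ _ => hJ0 _ _ _ _ _) (Finset.mem_univ s))
    have h3 : 0 < m₀ q u := (m₀_nonneg q u).lt_of_ne' fun h => h1.ne' (m_zero q a u h)
    refine ⟨h1, h2, h3, (P₀_nonneg q).lt_of_ne' fun h => h3.ne' (m₀_zero q u h), ?_⟩
    refine (hpQ.1 _).lt_of_ne' fun h => h1.ne' ?_
    rw [hm', h, zero_mul]
  have Bb_pos : ∀ q u a x s, J q u a x s ≠ 0 → 0 < ∑ u, mx q x u := fun q u a x s h =>
    (J_pos q u a x s h).2.1.trans_le (Finset.single_le_sum (f := fun u => mx q x u)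
      (fun _ _ => mx_nonneg _ _ _) (Finset.mem_univ u))
  -- the two information terms as expected log-likelihood ratios
  set I₁ : ℝ := ∑ q, ∑ u, ∑ a, ∑ x, ∑ s, J q u a x s *
    Real.log (A q a u / ∑ v, π q v * A q a v) with hI₁
  set I₂ : ℝ := ∑ q, ∑ u, ∑ a, ∑ x, ∑ s, J q u a x s *
    Real.log ((∑ v, π q v * B q x v) / B q x u) with hI₂
  have hI₁' : condMutualInfo (fun (u : 𝒰) (a : Q₁) (q : Q₀) =>
      ∑ s, ∑ x, jointLaw pQ p r u s (q, a) x) * Real.log 2 = I₁ := by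
    have h1 : ∀ u a q, (∑ s, ∑ x, jointLaw pQ p r u s (q, a) x) = m q a u := fun _ _ _ => rfl
    have h2 : ∀ q, ∑ u, ∑ a, m q a u = P₀ q := sum_m₀
    simp only [condMutualInfo, h1, h2, sum_m, hI₁, hAb, Finset.sum_mul _ _ (Real.log 2)]
    rw [Finset.sum_congr rfl fun u _ => Finset.sum_comm, Finset.sum_comm]
    refine Finset.sum_congr rfl fun q _ => Finset.sum_congr rfl fun u _ =>
      Finset.sum_congr rfl fun a _ => ?_
    rw [mul_assoc, Real.logb, div_mul_cancel₀ _ hlog.ne']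
    have e : ∑ x, ∑ s, J q u a x s = m q a u := Finset.sum_comm
    simp only [← Finset.sum_mul, hA, div_div_div_eq, e]
    rfl
  have hI₂' : condMutualInfo (fun (u : 𝒰) (x : X) (q : Q₀) =>
      ∑ s, ∑ a, jointLaw pQ p r u s (q, a) x) * Real.log 2 = -I₂ := by
    have h1 : ∀ u x q, (∑ s, ∑ a, jointLaw pQ p r u s (q, a) x) = mx q x u := fun _ _ _ => rfl
    simp only [condMutualInfo, h1, sum_mx, sum_m₀, hI₂, hBb, Finset.sum_mul _ _ (Real.log 2),
      ← Finset.sum_neg_distrib]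
    rw [Finset.sum_congr rfl fun u _ => Finset.sum_comm, Finset.sum_comm]
    refine Finset.sum_congr rfl fun q _ => Finset.sum_congr rfl fun u _ => ?_
    rw [Finset.sum_comm (s := (Finset.univ : Finset Q₁))]
    refine Finset.sum_congr rfl fun x _ => ?_
    rw [mul_assoc, Real.logb, div_mul_cancel₀ _ hlog.ne']
    have e : ∑ a, ∑ s, J q u a x s = mx q x u := Finset.sum_comm
    simp only [← mul_neg, ← Real.log_inv, inv_div, ← Finset.sum_mul, hB, div_div_eq_mul_div,
      div_mul_eq_mul_div, div_div, e]
    rw [mul_comm (m₀ q u), mul_comm (P₀ q)]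
  have hI₁0 : 0 ≤ I₁ := by
    rw [← hI₁']
    exact mul_nonneg (condMutualInfo_nonneg fun _ _ _ => m_nonneg _ _ _) hlog.le
  have hrate : rateExpr pQ p r * Real.log 2 = -I₂ - I₁ := by
    rw [rateExpr, sub_mul, hI₁', hI₂']
  have hR' : R * Real.log 2 < -I₂ - I₁ := by
    rw [← hrate]; exact mul_lt_mul_of_pos_right hR hlog
  -- A quarter of the rate gap. Bins of rate `I₁ + 2δ` leave the encoder a margin `δ` over the
  -- Chernoff level `I₁ + δ`, and the decoder a margin `δ` as well.
  obtain ⟨δ, hδ, hδ'⟩ : ∃ δ > 0, R * Real.log 2 + I₁ + I₂ + 3 * δ = -δ :=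
    ⟨(-I₂ - I₁ - R * Real.log 2) / 4, by linarith, by ring⟩
  -- exponents from Chernoff's bound
  obtain ⟨t, ht, ht1, hE⟩ := exists_sum_rpow_le_exp
    (m := fun z : Q₀ × 𝒰 × Q₁ × X × S => J z.1 z.2.1 z.2.2.1 z.2.2.2.1 z.2.2.2.2)
    (ρ := fun z => A z.1 z.2.2.1 z.2.1 / ∑ v, π z.1 v * A z.1 z.2.2.1 v) (D := I₁ + δ)
    (by simpa only [Fintype.sum_prod_type] using hJ1)
    (fun z hz => by
      obtain ⟨h1, h2, h3, h4, h5⟩ := J_pos _ _ _ _ _ hz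
      simp only [hAb]
      exact div_pos (div_pos h1 h3) (div_pos h5 h4))
    (by simp only [Fintype.sum_prod_type]; linarith)
  obtain ⟨t', ht', ht1', hE'⟩ := exists_sum_rpow_le_exp
    (m := fun z : Q₀ × 𝒰 × Q₁ × X × S => J z.1 z.2.1 z.2.2.1 z.2.2.2.1 z.2.2.2.2)
    (ρ := fun z => (∑ v, π z.1 v * B z.1 z.2.2.2.1 v) / B z.1 z.2.2.2.1 z.2.1) (D := I₂ + δ)
    (by simpa only [Fintype.sum_prod_type] using hJ1)
    (fun z hz => by
      obtain ⟨h1, h2, h3, h4, h5⟩ := J_pos _ _ _ _ _ hz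
      simp only [hBb]
      exact div_pos (div_pos (Bb_pos _ _ _ _ _ hz) h4) (div_pos h2 h3))
    (by simp only [Fintype.sum_prod_type]; linarith)
  simp only [Fintype.sum_prod_type] at hE hE'
  have hLpos : ∀ n : ℕ, 0 < ⌈Real.exp (n * (I₁ + 2 * δ))⌉₊ := fun n =>
    Nat.ceil_pos.2 (Real.exp_pos _)
  have hMpos : ∀ n : ℕ, 0 < ⌈(2 : ℝ) ^ ((n : ℝ) * R)⌉₊ := fun n => Nat.ceil_pos.2 (by positivity)
  choose c hc using fun n : ℕ => exists_code_errorProb_le hpQ hp P₀_nonneg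
    (π := π) (fun q u => div_nonneg (m₀_nonneg q u) (P₀_nonneg q))
    (fun q hq => by rw [← Finset.sum_div, sum_m₀, div_self hq])
    (A := A) (fun q a u => div_nonneg (m_nonneg q a u) (m₀_nonneg q u))
    (B := B) (fun q x u => div_nonneg (mx_nonneg q x u) (m₀_nonneg q u))
    (fun u q s => div_nonneg ((hr q).1 _) (Finset.sum_nonneg fun s _ => (hr q).1 _))
    (fun u q => sum_div_sum_le_one Finset.univ fun s => r q (u, s))
    (fun q a => by rw [hAb]; exact mul_div_cancel_of_imp' (pQ_zero q a)) hJfac hJ1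
    (fun q u a x s h => (div_pos (J_pos q u a x s h).2.1 (J_pos q u a x s h).2.2.1).ne')
    ht ht1 ht' ht1' n (hMpos n) (hLpos n)
  refine ⟨hR0, c, ?_⟩
  have hnn : 0 ≤ ∑ q, ∑ u, ∑ a, ∑ x, ∑ s, J q u a x s *
      (A q a u / ∑ v, π q v * A q a v) ^ t := by
    simp only [hAb]
    exact Finset.sum_nonneg fun q _ => Finset.sum_nonneg fun u _ => Finset.sum_nonneg fun a _ =>
      Finset.sum_nonneg fun x _ => Finset.sum_nonneg fun s _ => mul_nonneg (hJ0 q u a x s)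
        (Real.rpow_nonneg (div_nonneg (div_nonneg (m_nonneg q a u) (m₀_nonneg q u))
          (div_nonneg (hpQ.1 _) (P₀_nonneg q))) t)
  have hnn' : 0 ≤ ∑ q, ∑ u, ∑ a, ∑ x, ∑ s, J q u a x s *
      ((∑ v, π q v * B q x v) / B q x u) ^ t' := by
    simp only [hBb]
    exact Finset.sum_nonneg fun q _ => Finset.sum_nonneg fun u _ => Finset.sum_nonneg fun a _ =>
      Finset.sum_nonneg fun x _ => Finset.sum_nonneg fun s _ => mul_nonneg (hJ0 q u a x s)
        (Real.rpow_nonneg (div_nonneg (div_nonneg (Finset.sum_nonneg fun _ _ => mx_nonneg _ _ _)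
          (P₀_nonneg q)) (div_nonneg (mx_nonneg q x u) (m₀_nonneg q u))) t')
  have hbound : ∀ n : ℕ, errorProb pQ p (c n) ≤
      Real.exp (-(t * δ)) ^ n + (4 : ℝ) ^ t' * Real.exp (-(t' * δ)) ^ n := by
    intro n
    have hL1 : Real.exp (n * (I₁ + 2 * δ)) ≤ (⌈Real.exp (n * (I₁ + 2 * δ))⌉₊ : ℝ) :=
      Nat.le_ceil _
    -- Rounding up at most doubles a number that is at least one, here because `0 ≤ I₁`; the two
    -- roundings give the factor `4`.
    have hL2 : (⌈Real.exp (n * (I₁ + 2 * δ))⌉₊ : ℝ) ≤ 2 * Real.exp (n * (I₁ + 2 * δ)) := by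
      have h1 : 1 ≤ Real.exp (n * (I₁ + 2 * δ)) := Real.one_le_exp (by positivity)
      linarith [Nat.ceil_lt_add_one (Real.exp_pos (n * (I₁ + 2 * δ))).le]
    have h2pow : (2 : ℝ) ^ ((n : ℝ) * R) = Real.exp (n * (R * Real.log 2)) := by
      rw [Real.rpow_def_of_pos two_pos]; congr 1; ring
    have hM2 : (⌈(2 : ℝ) ^ ((n : ℝ) * R)⌉₊ : ℝ) ≤ 2 * Real.exp (n * (R * Real.log 2)) := by
      rw [h2pow]
      have h1 : 1 ≤ Real.exp (n * (R * Real.log 2)) := Real.one_le_exp (by positivity)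
      linarith [Nat.ceil_lt_add_one (Real.exp_pos (n * (R * Real.log 2))).le]
    refine (hc n).trans (add_le_add ?_ ?_)
    · have h1 : (1 / (⌈Real.exp (n * (I₁ + 2 * δ))⌉₊ : ℝ)) ^ t ≤
          Real.exp (-(n * (I₁ + 2 * δ)) * t) := by
        rw [Real.exp_mul (-(n * (I₁ + 2 * δ))) t, Real.exp_neg, ← one_div]
        exact Real.rpow_le_rpow (by positivity)
          (one_div_le_one_div_of_le (Real.exp_pos _) hL1) ht.le
      refine (mul_le_mul h1 (pow_le_pow_left₀ hnn hE n) (pow_nonneg hnn n)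
        (Real.exp_pos _).le).trans (le_of_eq ?_)
      rw [← Real.exp_nat_mul, ← Real.exp_nat_mul, ← Real.exp_add]
      congr 1
      ring
    · have h1 : ((⌈(2 : ℝ) ^ ((n : ℝ) * R)⌉₊ : ℝ) * (⌈Real.exp (n * (I₁ + 2 * δ))⌉₊ : ℝ)) ^ t' ≤
          (4 : ℝ) ^ t' * Real.exp (n * (R * Real.log 2 + I₁ + 2 * δ) * t') := by
        rw [Real.exp_mul (n * (R * Real.log 2 + I₁ + 2 * δ)) t', ← Real.mul_rpow (by norm_num) (Real.exp_pos _).le]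
        refine Real.rpow_le_rpow (by positivity) ((mul_le_mul hM2 hL2 (by positivity)
          (by positivity)).trans (le_of_eq ?_)) ht'.le
        have : Real.exp (n * (R * Real.log 2 + I₁ + 2 * δ)) =
            Real.exp (n * (R * Real.log 2)) * Real.exp (n * (I₁ + 2 * δ)) := by
          rw [← Real.exp_add]; congr 1; ring
        rw [this]
        ring
      refine (mul_le_mul h1 (pow_le_pow_left₀ hnn' hE' n) (pow_nonneg hnn' n)
        (by positivity)).trans (le_of_eq ?_)
      rw [← Real.exp_nat_mul, ← Real.exp_nat_mul, mul_assoc, ← Real.exp_add]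
      congr 2
      linear_combination (n : ℝ) * t' * hδ'
  have hlim : Tendsto (fun n : ℕ => Real.exp (-(t * δ)) ^ n +
      (4 : ℝ) ^ t' * Real.exp (-(t' * δ)) ^ n) atTop (𝓝 (0 + (4 : ℝ) ^ t' * 0)) := by
    refine Tendsto.add ?_ (Tendsto.const_mul _ ?_)
    · exact tendsto_pow_atTop_nhds_zero_of_lt_one (Real.exp_pos _).le
        (Real.exp_lt_one_iff.2 (neg_neg_of_pos (mul_pos ht hδ)))
    · exact tendsto_pow_atTop_nhds_zero_of_lt_one (Real.exp_pos _).le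
        (Real.exp_lt_one_iff.2 (neg_neg_of_pos (mul_pos ht' hδ)))
  rw [mul_zero, add_zero] at hlim
  refine squeeze_zero (fun n => ?_) hbound hlim
  rw [errorProb_eq_sum_codeLaw]
  exact Finset.sum_nonneg fun ω _ => mul_nonneg (codeLaw_nonneg hpQ.1 hp _ _)
    (by split_ifs <;> simp)

omit [Fintype S] in
-- At rate zero there is a single semantic, so no error is possible.
theorem achievable_zero [Nonempty S] (pQ : Q₀ × Q₁ → ℝ) (p : S → Q₀ × Q₁ → X → ℝ) :
    Achievable pQ p 0 := by
  have hM : ∀ n : ℕ, ⌈(2 : ℝ) ^ ((n : ℝ) * 0)⌉₊ = 1 := fun n => by simp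
  refine ⟨le_rfl, fun n => ⟨fun _ _ _ => Classical.arbitrary S,
    fun _ _ => ⟨0, by rw [hM]; exact one_pos⟩⟩, ?_⟩
  have : ∀ n : ℕ, ∀ w v : Fin ⌈(2 : ℝ) ^ ((n : ℝ) * 0)⌉₊, w = v := by
    intro n w v
    have h := hM n
    exact Fin.ext (by omega)
  have hzero : ∀ n, errorProb pQ p (n := n) (M := ⌈(2 : ℝ) ^ ((n : ℝ) * 0)⌉₊)
      ⟨fun _ _ _ => Classical.arbitrary S, fun _ _ => ⟨0, by rw [hM]; exact one_pos⟩⟩ = 0 := by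
    intro n
    simp only [errorProb, if_pos (this n _ _), mul_zero, Finset.sum_const_zero]
  simp only [hzero]
  exact tendsto_const_nhds

end

end SemanticChannel

/-! ### The capacity formula -/

theorem theorem3 {Q₀ Q₁ S X : Type*} [Fintype Q₀] [Fintype Q₁] [Fintype S] [Fintype X] [Nonempty S]
    (pQ : Q₀ × Q₁ → ℝ) (hpQ : pQ ∈ stdSimplex ℝ (Q₀ × Q₁))
    (p : S → Q₀ × Q₁ → X → ℝ) (hp : ∀ s q, p s q ∈ stdSimplex ℝ X) :
    IsLUB {R : ℝ | SemanticChannel.Achievable pQ p R} (SemanticChannel.capacity pQ p) ∧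
    IsGreatest {I : ℝ | ∃ (k : ℕ) (r : Q₀ × Q₁ → Fin k × S → ℝ),
        (∀ q, r q ∈ stdSimplex ℝ (Fin k × S)) ∧ I = SemanticChannel.rateExpr pQ p r}
      (SemanticChannel.capacity pQ p) := by
  obtain ⟨k, r, hr, hmax⟩ := SemanticChannel.exists_max_rateExpr hpQ hp
  have h0 := SemanticChannel.achievable_zero pQ p
  have hlub : IsLUB {R : ℝ | SemanticChannel.Achievable pQ p R}
      (SemanticChannel.rateExpr pQ p r) := by
    refine ⟨fun R hR => hR.le_of_rateExpr_le hpQ hp hmax, fun b hb => ?_⟩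
    by_contra! hlt
    -- Achievable rates must be nonnegative; `b ≥ 0` makes the midpoint between `b` and the maximum
    -- an achievable rate above `b`.
    have hb0 : 0 ≤ b := hb h0
    have := hb (SemanticChannel.achievable_of_lt_rateExpr hpQ hp hr
      (R := (SemanticChannel.rateExpr pQ p r + b) / 2) (by linarith) (by linarith))
    linarith
  have hcap : SemanticChannel.capacity pQ p = SemanticChannel.rateExpr pQ p r :=
    hlub.csSup_eq ⟨0, h0⟩
  rw [hcap]
  refine ⟨hlub, ⟨k, r, hr, rfl⟩, ?_⟩
  rintro _ ⟨l, r', hr', rfl⟩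
  exact hmax l r' hr'
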